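/- **Setting.** Let $(G,H,\alpha,\tau)$ be a Lie crossed module: $G,H$ are Lie groups, $\tau:H\to G$ is a smooth homomorphism, $\alpha:G\to\mathrm{Aut}(H)$ is a homomorphism with $(g,h)\mapsto\alpha(g)h$ smooth, and $\tau(\alpha(g)h)=g\tau(h)g^{-1}$, $\alpha(\tau(h))h'=hh'h^{-1}$. Let $\mathbf K$ be its categorical group: the objects are the elements of $G$; a morphism $a\to b$ is a pair $(h,a)$ with $h\in H$ and $\tau(h)a=b$; composition is $(h_2,b)\circ(h_1,a)=(h_2h_1,a)$; the group law on objects is that of $G$, and on morphisms it is $(h,a)(k,c)=(h\,\alpha(a)(k),ac)$. Let $\pi:P\to M$ be a smooth principal $G$-bundle and $\bar A$ a connection form on it. *Paths.* Paths are piecewise $C^1$ maps on compact intervals (one-point intervals are allowed). Two paths $c_1,c_2$ in a manifold are elementarily backtrack equivalent if, after reparametrizing each by a strictly increasing piecewise $C^1$ map of a closed interval onto its domain, one of them is $a\,d\,d^{-1}\,b$ and the other is $ab$ for some paths $a,b,d$, where juxtaposition is concatenation and $d^{-1}$ is the reverse of $d$. Backtrack equivalence is the equivalence relation this generates, and a backtrack-erased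 path is an equivalence class. Let $\mathbb P^{\rm bt}(M)$ be the category whose objects are the points of $M$ and whose morphisms are the backtrack-erased paths on $M$, composed by concatenation. *Decorated paths.* Let $\mathbb P^{\rm bt}(P)^{\rm dec}_{\bar A}$ be the category whose objects are the points of $P$ and whose morphisms are the pairs $(\tilde\gamma,h)$, where $\tilde\gamma$ is the backtrack equivalence class of an $\bar A$-horizontal path on $P$ and $h\in H$, with source $s(\tilde\gamma)$, target $t(\tilde\gamma)\tau(h^{-1})$ and composition $$(\tilde\gamma_2,h_2)\circ(\tilde\gamma_1,h_1)=\bigl(\tilde\gamma_2\tau(h_1)\circ\tilde\gamma_1,\;h_2h_1\bigr).$$ **Theorem.** The assignments $p\mapsto\pi(p)$, $(\tilde\gamma,h)\mapsto\pi\circ\tilde\gamma$ define a functor $\pi:\mathbb P^{\rm bt}(P)^{\rm dec}_{\bar A}\to\mathbb P^{\rm bt}(M)$, and $$(p,g)\mapsto pg,\qquad \bigl((\tilde\gamma,h),(h_1,g_1)\bigr)\mapsto\bigl(\tilde\gamma g_1,\ \alpha(g_1^{-1})(h_1^{-1}h)\bigr)$$ define a functor $\mathbb P^{\rm bt}(P)^{\rm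 dec}_{\bar A}\times\mathbf K\to\mathbb P^{\rm bt}(P)^{\rm dec}_{\bar A}$. Together they form a principal categorical bundle, that is: $\pi$ is surjective on objects and on morphisms; the second functor is a right action of the group of objects of $\mathbf K$ on the objects and a right action of the group of morphisms of $\mathbf K$ on the morphisms; both actions are free; and they preserve, and act transitively on, the fibers of $\pi$ over each object and over each morphism of $\mathbb P^{\rm bt}(M)$. -/

import Mathlib

open CategoryTheory
open scoped Manifold ContDiff

set_option linter.unusedSectionVars false

noncomputable section

namespace CatBundle

/-! ### Categorical groups, right actions, principal categorical bundles

The set of all morphisms of a category `C` is `Arrow C`. -/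

/-- A categorical group: a category `K` with a bifunctor `⊗ : K × K ⥤ K` that is a group operation
both on the set of objects and on the set of morphisms. -/
class CategoricalGroup (K : Type*) [Category K] [Group K] [Group (Arrow K)] where
  tensor : K × K ⥤ K
  tensor_obj : ∀ a b : K, tensor.obj (a, b) = a * b
  tensor_map : ∀ f g : Arrow K, Arrow.mk (tensor.map (Prod.mkHom f.hom g.hom)) = f * g

/-- The map `Mor P × Mor K → Mor P` given by a functor `P × K ⥤ P`. -/
def actMor {P K : Type*} [Category P] [Category K] (ρ : P × K ⥤ P)
    (F : Arrow P) (φ : Arrow K) : Arrow P :=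
  Arrow.mk (ρ.map (Prod.mkHom F.hom φ.hom))

/-- A functor `ρ : P × K ⥤ P` is a right action of the categorical group `K` on `P` if it is a
right action of groups on the objects and on the morphisms. -/
structure IsRightAction {P K : Type*} [Category P] [Category K] [Group K] [Group (Arrow K)]
    [CategoricalGroup K] (ρ : P × K ⥤ P) : Prop where
  obj_one : ∀ p : P, ρ.obj (p, 1) = p
  obj_mul : ∀ (p : P) (a b : K), ρ.obj (ρ.obj (p, a), b) = ρ.obj (p, a * b)
  mor_one : ∀ F : Arrow P, actMor ρ F 1 = F
  mor_mul : ∀ (F : Arrow P) (φ ψ : Arrow K), actMor ρ (actMor ρ F φ) ψ = actMor ρ F (φ * ψ)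

/-- A principal categorical bundle: a functor `π : P ⥤ B` surjective on objects and morphisms, and
a right action of a categorical group `K` on `P`, free on objects and morphisms, which preserves
the fibers of `π` over objects and over morphisms and is transitive on each of them. -/
structure IsPrincipalCategoricalBundle {P B K : Type*} [Category P] [Category B] [Category K]
    [Group K] [Group (Arrow K)] [CategoricalGroup K] (π : P ⥤ B) (ρ : P × K ⥤ P) : Prop where
  rightAction : IsRightAction ρ
  obj_surjective : Function.Surjective π.obj
  mor_surjective : Function.Surjective π.mapArrow.obj
  obj_free : ∀ (p : P) (a : K), ρ.obj (p, a) = p → a = 1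
  mor_free : ∀ (F : Arrow P) (φ : Arrow K), actMor ρ F φ = F → φ = 1
  obj_fiber : ∀ (p : P) (a : K), π.obj (ρ.obj (p, a)) = π.obj p
  mor_fiber : ∀ (F : Arrow P) (φ : Arrow K), π.mapArrow.obj (actMor ρ F φ) = π.mapArrow.obj F
  obj_transitive : ∀ p q : P, π.obj p = π.obj q → ∃ a : K, ρ.obj (p, a) = q
  mor_transitive : ∀ F F' : Arrow P, π.mapArrow.obj F = π.mapArrow.obj F' →
    ∃ φ : Arrow K, actMor ρ F φ = F'

/-! ### Lie crossed modules and their categorical groups -/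

/-- A Lie crossed module `(G, H, α, τ)`. -/
structure LieCrossedModule (EG EH G H : Type*)
    [NormedAddCommGroup EG] [NormedSpace ℝ EG] [NormedAddCommGroup EH] [NormedSpace ℝ EH]
    [TopologicalSpace G] [ChartedSpace EG G] [Group G]
    [TopologicalSpace H] [ChartedSpace EH H] [Group H] where
  τ : H →* G
  α : G →* MulAut H
  τ_α : ∀ (g : G) (h : H), τ (α g h) = g * τ h * g⁻¹
  α_τ : ∀ h h' : H, α (τ h) h' = h * h' * h⁻¹
  contMDiff_τ : ContMDiff 𝓘(ℝ, EH) 𝓘(ℝ, EG) ∞ τ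
  contMDiff_α : ContMDiff (𝓘(ℝ, EG).prod 𝓘(ℝ, EH)) 𝓘(ℝ, EH) ∞ (fun x : G × H => α x.1 x.2)

section CrossedModule

variable {EG EH G H : Type*}
  [NormedAddCommGroup EG] [NormedSpace ℝ EG] [NormedAddCommGroup EH] [NormedSpace ℝ EH]
  [TopologicalSpace G] [ChartedSpace EG G] [Group G]
  [TopologicalSpace H] [ChartedSpace EH H] [Group H]

/-- The object set `G` of the category of a crossed module. -/
@[nolint unusedArguments]
def LieCrossedModule.Cat (_ : LieCrossedModule EG EH G H) : Type _ := G

variable (X : LieCrossedModule EG EH G H)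

instance : Group X.Cat := inferInstanceAs (Group G)

/-- An element of `X.Cat` seen as an element of `G`. -/
def LieCrossedModule.Cat.toGroup {X : LieCrossedModule EG EH G H} (a : X.Cat) : G := a

/-- A morphism `a ⟶ b` is an `h : H` with `τ(h) a = b`; this is the pair `(h, a)`.
The composite of `(h₁, a)` followed by `(h₂, b)` is `(h₂ h₁, a)`. -/
instance : Category X.Cat where
  Hom a b := {h : H // X.τ h * a.toGroup = b.toGroup}
  id a := ⟨1, by simp⟩
  comp f g := ⟨g.1 * f.1, by rw [map_mul, mul_assoc, f.2, g.2]⟩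
  id_comp f := Subtype.ext (mul_one f.1)
  comp_id f := Subtype.ext (one_mul f.1)
  assoc f g k := Subtype.ext (mul_assoc k.1 g.1 f.1).symm

/-- The product `(h, a) (k, c) = (h α(a)(k), a c)` of morphisms. -/
def LieCrossedModule.mulHom {a b c d : X.Cat} (f : a ⟶ b) (g : c ⟶ d) : a * c ⟶ b * d :=
  ⟨f.1 * X.α a.toGroup g.1, by
    obtain ⟨f, hf⟩ := f
    obtain ⟨g, hg⟩ := g
    change X.τ (f * X.α a.toGroup g) * (a.toGroup * c.toGroup) = b.toGroup * d.toGroup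
    rw [← hf, ← hg, map_mul, X.τ_α]
    group⟩

theorem LieCrossedModule.arrow_ext {f g : Arrow X.Cat} (h₁ : f.left = g.left)
    (h₂ : f.hom.1 = g.hom.1) : f = g := by
  obtain ⟨a, b, f⟩ := f
  obtain ⟨a', b', g⟩ := g
  obtain ⟨f, hf⟩ := f
  obtain ⟨g, hg⟩ := g
  dsimp at h₁ h₂
  subst h₁ h₂
  have hb : b = b' := hf.symm.trans hg
  subst hb
  rfl

instance : Group (Arrow X.Cat) where
  mul f g := Arrow.mk (X.mulHom f.hom g.hom)
  one := Arrow.mk (𝟙 (1 : X.Cat))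
  inv f := Arrow.mk (X := (f.left⁻¹ : X.Cat)) (Y := (f.right⁻¹ : X.Cat))
    ⟨X.α (f.left.toGroup)⁻¹ f.hom.1⁻¹, by
      obtain ⟨h, hf⟩ := f.hom
      change X.τ (X.α (f.left.toGroup)⁻¹ h⁻¹) * (f.left.toGroup)⁻¹ = (f.right.toGroup)⁻¹
      rw [← hf, X.τ_α, map_inv]
      group⟩
  mul_assoc f g k := X.arrow_ext (mul_assoc (G := X.Cat) f.left g.left k.left) (by
    change f.hom.1 * X.α f.left.toGroup g.hom.1 *
        X.α (f.left.toGroup * g.left.toGroup) k.hom.1 =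
      f.hom.1 * X.α f.left.toGroup (g.hom.1 * X.α g.left.toGroup k.hom.1)
    simp [mul_assoc])
  one_mul f := X.arrow_ext (one_mul (M := X.Cat) f.left) (by
    change 1 * X.α (1 : G) f.hom.1 = f.hom.1
    simp)
  mul_one f := X.arrow_ext (mul_one (M := X.Cat) f.left) (by
    change f.hom.1 * X.α f.left.toGroup 1 = f.hom.1
    simp)
  inv_mul_cancel f := X.arrow_ext (inv_mul_cancel (G := X.Cat) f.left) (by
    change X.α (f.left.toGroup)⁻¹ f.hom.1⁻¹ * X.α (f.left.toGroup)⁻¹ f.hom.1 = 1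
    rw [← map_mul]
    simp)

/-- The categorical group of the crossed module. -/
instance : CategoricalGroup X.Cat where
  tensor :=
    { obj := fun x => x.1 * x.2
      map := fun f => X.mulHom f.1 f.2
      map_id := fun x => Subtype.ext (by
        change 1 * X.α x.1.toGroup 1 = 1
        simp)
      map_comp := fun {x y z} f g => Subtype.ext (by
        have hf : y.1.toGroup = X.τ f.1.1 * x.1.toGroup := f.1.2.symm
        have key : X.α y.1.toGroup g.2.1 =
            f.1.1 * X.α x.1.toGroup g.2.1 * f.1.1⁻¹ := by
          rw [congrArg (X.α) hf, map_mul X.α, MulAut.mul_apply, X.α_τ]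
        change g.1.1 * f.1.1 * X.α x.1.toGroup (g.2.1 * f.2.1) =
          g.1.1 * X.α y.1.toGroup g.2.1 * (f.1.1 * X.α x.1.toGroup f.2.1)
        rw [key, map_mul]
        group) }
  tensor_obj _ _ := rfl
  tensor_map _ _ := rfl

end CrossedModule

/-! ### Piecewise `C¹` paths and backtrack equivalence -/

section Paths

variable {E X : Type*} [NormedAddCommGroup E] [NormedSpace ℝ E]
  [TopologicalSpace X] [ChartedSpace E X]

/-- `f` is piecewise `C¹` on `[a, b]`: apart from finitely many points, it is `C¹` on every closed
subinterval whose interior avoids these points. -/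
def PiecewiseC1 (E : Type*) {X : Type*} [NormedAddCommGroup E] [NormedSpace ℝ E]
    [TopologicalSpace X] [ChartedSpace E X] (f : ℝ → X) (a b : ℝ) : Prop :=
  ∃ S : Finset ℝ, ∀ u v : ℝ, a ≤ u → v ≤ b → (∀ s ∈ S, s ∉ Set.Ioo u v) →
    ContMDiffOn 𝓘(ℝ, ℝ) 𝓘(ℝ, E) 1 f (Set.Icc u v)

/-- The concatenation of `f` on `[0, a]` with `g` on `[0, b]`. -/
def glue {X : Type*} (a : ℝ) (f g : ℝ → X) (t : ℝ) : X := if t ≤ a then f t else g (t - a)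

theorem PiecewiseC1.congr {f g : ℝ → X} {a b : ℝ} (hf : PiecewiseC1 E f a b)
    (h : Set.EqOn g f (Set.Icc a b)) : PiecewiseC1 E g a b := by
  obtain ⟨S, hS⟩ := hf
  exact ⟨S, fun u v hu hv hs => (hS u v hu hv hs).congr
    fun t ht => h ⟨hu.trans ht.1, ht.2.trans hv⟩⟩

theorem PiecewiseC1.comp {E' Y : Type*} [NormedAddCommGroup E'] [NormedSpace ℝ E']
    [TopologicalSpace Y] [ChartedSpace E' Y] {F : X → Y} (hF : ContMDiff 𝓘(ℝ, E) 𝓘(ℝ, E') 1 F)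
    {f : ℝ → X} {a b : ℝ} (hf : PiecewiseC1 E f a b) : PiecewiseC1 E' (fun t => F (f t)) a b := by
  obtain ⟨S, hS⟩ := hf
  exact ⟨S, fun u v hu hv hs => hF.comp_contMDiffOn (hS u v hu hv hs)⟩

theorem PiecewiseC1.of_contMDiff {f : ℝ → X} (hf : ContMDiff 𝓘(ℝ, ℝ) 𝓘(ℝ, E) 1 f) (a b : ℝ) :
    PiecewiseC1 E f a b :=
  ⟨∅, fun _ _ _ _ _ => hf.contMDiffOn⟩

theorem PiecewiseC1.glue {f g : ℝ → X} {a b : ℝ} (hf : PiecewiseC1 E f 0 a)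
    (hg : PiecewiseC1 E g 0 b) (h : f a = g 0) :
    PiecewiseC1 E (CatBundle.glue a f g) 0 (a + b) := by
  classical
  obtain ⟨S, hS⟩ := hf
  obtain ⟨S', hS'⟩ := hg
  refine ⟨S ∪ S'.image (fun s => s + a) ∪ {a}, fun u v hu hv hs => ?_⟩
  have ha : a ∉ Set.Ioo u v := hs a (by simp)
  rcases le_or_gt v a with hva | hva
  · refine (hS u v hu hva fun s hs' => hs s (by simp [hs'])).congr fun t ht => ?_
    simp [CatBundle.glue, ht.2.trans hva]
  · have hau : a ≤ u := by
      by_contra hc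
      exact ha ⟨not_le.1 hc, hva⟩
    have h1 := hS' (u - a) (v - a) (by linarith) (by linarith) (fun s hs' hc =>
      hs (s + a) (by simp [hs']) ⟨by linarith [hc.1], by linarith [hc.2]⟩)
    have h2 : ContMDiff 𝓘(ℝ, ℝ) 𝓘(ℝ, ℝ) 1 (fun t : ℝ => t - a) :=
      (contDiff_id.sub contDiff_const).contMDiff
    refine (h1.comp h2.contMDiffOn (fun t ht => ⟨by linarith [ht.1], by linarith [ht.2]⟩)).congr
      fun t ht => ?_
    rcases (hau.trans ht.1).eq_or_lt with rfl | hlt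
    · simp [CatBundle.glue, h]
    · simp [CatBundle.glue, not_le.2 hlt]

theorem PiecewiseC1.reverse {f : ℝ → X} {a : ℝ} (hf : PiecewiseC1 E f 0 a) :
    PiecewiseC1 E (fun t => f (a - t)) 0 a := by
  classical
  obtain ⟨S, hS⟩ := hf
  refine ⟨S.image (fun s => a - s), fun u v hu hv hs => ?_⟩
  have h1 := hS (a - v) (a - u) (by linarith) (by linarith) (fun s hs' hc =>
      hs (a - s) (Finset.mem_image_of_mem _ hs') ⟨by linarith [hc.2], by linarith [hc.1]⟩)
  have h2 : ContMDiff 𝓘(ℝ, ℝ) 𝓘(ℝ, ℝ) 1 (fun t : ℝ => a - t) :=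
    (contDiff_const.sub contDiff_id).contMDiff
  exact h1.comp h2.contMDiffOn (fun t ht => ⟨by linarith [ht.2], by linarith [ht.1]⟩)

/-- A parametrized piecewise `C¹` path from `x` to `y`. By a translation of time its domain is
`[0, len]`; the values of `toFun` elsewhere are irrelevant. The domain may be a single point. -/
structure PwPath (E : Type*) {X : Type*} [NormedAddCommGroup E] [NormedSpace ℝ E]
    [TopologicalSpace X] [ChartedSpace E X] (x y : X) where
  len : ℝ
  toFun : ℝ → X
  len_nonneg : 0 ≤ len
  source : toFun 0 = x
  target : toFun len = y
  piecewiseC1 : PiecewiseC1 E toFun 0 len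

namespace PwPath

variable {x y z w : X}

theorem ext' {p q : PwPath E x y} (h₁ : p.len = q.len) (h₂ : p.toFun = q.toFun) : p = q := by
  cases p
  cases q
  cases h₁
  cases h₂
  rfl

/-- The path with a one-point domain. -/
def refl (E : Type*) {X : Type*} [NormedAddCommGroup E] [NormedSpace ℝ E]
    [TopologicalSpace X] [ChartedSpace E X] (x : X) : PwPath E x x where
  len := 0
  toFun _ := x
  len_nonneg := le_rfl
  source := rfl
  target := rfl
  piecewiseC1 := .of_contMDiff contMDiff_const 0 0

/-- The path `p` followed by the path `q`. -/
def trans (p : PwPath E x y) (q : PwPath E y z) : PwPath E x z where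
  len := p.len + q.len
  toFun := glue p.len p.toFun q.toFun
  len_nonneg := add_nonneg p.len_nonneg q.len_nonneg
  source := by simp [glue, p.len_nonneg, p.source]
  target := by
    rcases q.len_nonneg.eq_or_lt with h | h
    · have h1 := q.source
      rw [h, q.target] at h1
      simp [glue, ← h, p.target, h1]
    · simp [glue, h, q.target]
  piecewiseC1 := p.piecewiseC1.glue q.piecewiseC1 (p.target.trans q.source.symm)

/-- The reverse of a path. -/
def symm (p : PwPath E x y) : PwPath E y x where
  len := p.len
  toFun t := p.toFun (p.len - t)
  len_nonneg := p.len_nonneg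
  source := by simp [p.target]
  target := by simp [p.source]
  piecewiseC1 := p.piecewiseC1.reverse

/-- The image of a path under a `C¹` map. -/
def map {E' Y : Type*} [NormedAddCommGroup E'] [NormedSpace ℝ E']
    [TopologicalSpace Y] [ChartedSpace E' Y] {F : X → Y} (hF : ContMDiff 𝓘(ℝ, E) 𝓘(ℝ, E') 1 F)
    (p : PwPath E x y) : PwPath E' (F x) (F y) where
  len := p.len
  toFun t := F (p.toFun t)
  len_nonneg := p.len_nonneg
  source := by rw [p.source]
  target := by rw [p.target]
  piecewiseC1 := p.piecewiseC1.comp hF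

/-- `IsReparam p c` says that `p = c ∘ φ` for a strictly increasing piecewise `C¹` map `φ` of the
domain of `p` onto the domain of `c`. -/
def IsReparam (p c : PwPath E x y) : Prop :=
  ∃ φ : ℝ → ℝ, StrictMonoOn φ (Set.Icc 0 p.len) ∧ PiecewiseC1 ℝ φ 0 p.len ∧
    φ 0 = 0 ∧ φ p.len = c.len ∧ ∀ t ∈ Set.Icc 0 p.len, p.toFun t = c.toFun (φ t)

/-- Elementary backtrack equivalence: up to reparametrization, one of the paths is `a d d⁻¹ b` and
the other one is `a b`. -/
def ElemBacktrack (c₁ c₂ : PwPath E x y) : Prop :=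
  ∃ (z w : X) (a : PwPath E x z) (d : PwPath E z w) (b : PwPath E z y),
    (IsReparam (a.trans (d.trans (d.symm.trans b))) c₁ ∧ IsReparam (a.trans b) c₂) ∨
    (IsReparam (a.trans (d.trans (d.symm.trans b))) c₂ ∧ IsReparam (a.trans b) c₁)

theorem isReparam_of_eqOn {p c : PwPath E x y} (h₁ : p.len = c.len)
    (h₂ : Set.EqOn p.toFun c.toFun (Set.Icc 0 p.len)) : IsReparam p c :=
  ⟨fun t => t, fun _ _ _ _ h => h, .of_contMDiff contMDiff_id _ _, rfl, h₁, h₂⟩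

theorem IsReparam.bounds {p c : PwPath E x y} {φ : ℝ → ℝ}
    (hm : StrictMonoOn φ (Set.Icc 0 p.len)) (h₀ : φ 0 = 0) (h₁ : φ p.len = c.len) {t : ℝ}
    (ht : t ∈ Set.Icc 0 p.len) : φ t ∈ Set.Icc 0 c.len := by
  constructor
  · rw [← h₀]
    exact hm.monotoneOn ⟨le_rfl, p.len_nonneg⟩ ht ht.1
  · rw [← h₁]
    exact hm.monotoneOn ht ⟨p.len_nonneg, le_rfl⟩ ht.2

theorem IsReparam.trans {p c : PwPath E x y} {q d : PwPath E y z} (h : IsReparam p c)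
    (h' : IsReparam q d) : IsReparam (p.trans q) (c.trans d) := by
  obtain ⟨φ, hm, hφ, h0, h1, he⟩ := h
  obtain ⟨ψ, hm', hψ, h0', h1', he'⟩ := h'
  have bφ := fun {t} ht => IsReparam.bounds (p := p) (c := c) hm h0 h1 (t := t) ht
  have pos : ∀ {s}, s ∈ Set.Icc 0 q.len → 0 < s → 0 < ψ s := fun {s} hs h => by
    rw [← h0']
    exact hm' ⟨le_rfl, q.len_nonneg⟩ hs h
  have mem : ∀ {t}, t ∈ Set.Icc 0 (p.len + q.len) → p.len < t → t - p.len ∈ Set.Icc 0 q.len :=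
    fun {t} ht h => ⟨by linarith, by linarith [ht.2]⟩
  refine ⟨glue p.len φ (fun t => c.len + ψ t), ?_, ?_, ?_, ?_, ?_⟩
  · intro s hs t ht hst
    change s ∈ Set.Icc 0 (p.len + q.len) at hs
    change t ∈ Set.Icc 0 (p.len + q.len) at ht
    by_cases hs' : s ≤ p.len <;> by_cases ht' : t ≤ p.len
    · simpa [glue, hs', ht'] using hm ⟨hs.1, hs'⟩ ⟨ht.1, ht'⟩ hst
    · have a1 := (bφ ⟨hs.1, hs'⟩).2
      have a2 := pos (mem ht (not_le.1 ht')) (by linarith)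
      simp only [glue, hs', ht', if_true, if_false]
      linarith
    · exact absurd (hst.le.trans ht') hs'
    · simpa [glue, hs', ht'] using
        hm' (mem hs (not_le.1 hs')) (mem ht (not_le.1 ht')) (by linarith)
  · refine PiecewiseC1.glue hφ (hψ.comp (F := fun t => c.len + t) ?_) (by simp [h1, h0'])
    exact (contDiff_const.add contDiff_id).contMDiff
  · simp [glue, p.len_nonneg, h0]
  · change glue p.len φ (fun t => c.len + ψ t) (p.len + q.len) = c.len + d.len
    rcases q.len_nonneg.eq_or_lt with h | h
    · have : d.len = 0 := by rw [← h1', ← h, h0']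
      simp [glue, ← h, h1, this]
    · simp [glue, h, h1']
  · intro t ht
    change t ∈ Set.Icc 0 (p.len + q.len) at ht
    change glue p.len p.toFun q.toFun t = glue c.len c.toFun d.toFun (glue p.len φ _ t)
    by_cases ht' : t ≤ p.len
    · simp [glue, ht', (bφ ⟨ht.1, ht'⟩).2, he t ⟨ht.1, ht'⟩]
    · have a1 := mem ht (not_le.1 ht')
      have a2 := pos a1 (by linarith)
      simp [glue, ht', a2, he' _ a1]

theorem trans_assoc (p : PwPath E x y) (q : PwPath E y z) (r : PwPath E z w) :
    (p.trans q).trans r = p.trans (q.trans r) := by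
  refine ext' (add_assoc _ _ _) (funext fun t => ?_)
  have hq := q.len_nonneg
  simp only [trans, glue]
  by_cases h1 : t ≤ p.len
  · have h2 : t ≤ p.len + q.len := by linarith
    simp [h1, h2]
  · by_cases h2 : t ≤ p.len + q.len
    · have h3 : t - p.len ≤ q.len := by linarith
      simp [h1, h2, h3]
    · have h3 : ¬ t - p.len ≤ q.len := by intro h; exact h2 (by linarith)
      simp [h1, h2, h3, sub_sub]

theorem isReparam_refl_trans (p : PwPath E x y) : IsReparam ((refl E x).trans p) p := by
  refine isReparam_of_eqOn (zero_add _) fun t ht => ?_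
  rcases ht.1.eq_or_lt with rfl | h
  · simp [trans, refl, glue, p.source]
  · simp [trans, refl, glue, h]

theorem isReparam_trans_refl (p : PwPath E x y) : IsReparam (p.trans (refl E y)) p := by
  refine isReparam_of_eqOn (add_zero _) fun t ht => ?_
  have : t ≤ p.len := by simpa [trans, refl] using ht.2
  simp [trans, glue, this]

theorem isReparam_self (p : PwPath E x y) : IsReparam p p :=
  isReparam_of_eqOn rfl fun _ _ => rfl

theorem IsReparam.comp {p q r : PwPath E x y} (h : IsReparam p q) (h' : q.len = r.len)
    (h'' : Set.EqOn q.toFun r.toFun (Set.Icc 0 q.len)) : IsReparam p r := by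
  obtain ⟨φ, hm, hφ, h0, h1, he⟩ := h
  exact ⟨φ, hm, hφ, h0, h1.trans h', fun t ht =>
    (he t ht).trans (h'' (IsReparam.bounds hm h0 h1 ht))⟩

/-- A path is backtrack equivalent to each of its reparametrizations. -/
theorem ElemBacktrack.of_isReparam {p c : PwPath E x y} (h : IsReparam p c) :
    ElemBacktrack p c := by
  refine ⟨x, x, refl E x, refl E x, p, Or.inl ⟨?_, ?_⟩⟩
  · have h1 : (refl E x).symm = refl E x := ext' rfl rfl
    rw [h1]
    refine isReparam_of_eqOn (by simp [trans, refl]) fun t ht => ?_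
    rcases ht.1.eq_or_lt with rfl | h
    · simp [trans, refl, glue, p.source]
    · simp [trans, refl, glue, not_le.2 h]
  · obtain ⟨φ, hm, hφ, h0, h1, he⟩ := h
    have hl : ((refl E x).trans p).len = p.len := by simp [trans, refl]
    refine ⟨φ, by rwa [hl], by rwa [hl], h0, by rwa [hl], fun t ht => ?_⟩
    rw [hl] at ht
    rw [← he t ht]
    rcases ht.1.eq_or_lt with rfl | h
    · simp [trans, refl, glue, p.source]
    · simp [trans, refl, glue, h]

theorem ElemBacktrack.trans_left {c₁ c₂ : PwPath E x y} (h : ElemBacktrack c₁ c₂)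
    (e : PwPath E y z) : ElemBacktrack (c₁.trans e) (c₂.trans e) := by
  obtain ⟨u, v, a, d, b, h⟩ := h
  refine ⟨u, v, a, d, b.trans e, ?_⟩
  simp only [← trans_assoc] at h ⊢
  exact h.imp (fun h => ⟨h.1.trans (isReparam_self e), h.2.trans (isReparam_self e)⟩)
    (fun h => ⟨h.1.trans (isReparam_self e), h.2.trans (isReparam_self e)⟩)

theorem ElemBacktrack.trans_right {c₁ c₂ : PwPath E y z} (h : ElemBacktrack c₁ c₂)
    (e : PwPath E x y) : ElemBacktrack (e.trans c₁) (e.trans c₂) := by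
  obtain ⟨u, v, a, d, b, h⟩ := h
  refine ⟨u, v, e.trans a, d, b, ?_⟩
  simp only [trans_assoc e]
  exact h.imp (fun h => ⟨(isReparam_self e).trans h.1, (isReparam_self e).trans h.2⟩)
    (fun h => ⟨(isReparam_self e).trans h.1, (isReparam_self e).trans h.2⟩)

theorem map_trans {E' Y : Type*} [NormedAddCommGroup E'] [NormedSpace ℝ E']
    [TopologicalSpace Y] [ChartedSpace E' Y] {F : X → Y} (hF : ContMDiff 𝓘(ℝ, E) 𝓘(ℝ, E') 1 F)
    (p : PwPath E x y) (q : PwPath E y z) : (p.trans q).map hF = (p.map hF).trans (q.map hF) :=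
  ext' rfl (funext fun t => by simp only [map, trans, glue]; split_ifs <;> rfl)

theorem ElemBacktrack.map {E' Y : Type*} [NormedAddCommGroup E'] [NormedSpace ℝ E']
    [TopologicalSpace Y] [ChartedSpace E' Y] {F : X → Y} (hF : ContMDiff 𝓘(ℝ, E) 𝓘(ℝ, E') 1 F)
    {c₁ c₂ : PwPath E x y} (h : ElemBacktrack c₁ c₂) :
    ElemBacktrack (c₁.map hF) (c₂.map hF) := by
  have key : ∀ {p c : PwPath E x y}, IsReparam p c → IsReparam (p.map hF) (c.map hF) := by
    rintro p c ⟨φ, hm, hφ, h0, h1, he⟩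
    exact ⟨φ, hm, hφ, h0, h1, fun t ht => congrArg F (he t ht)⟩
  obtain ⟨u, v, a, d, b, h⟩ := h
  refine ⟨F u, F v, a.map hF, d.map hF, b.map hF, ?_⟩
  have h1 : (d.map hF).symm = d.symm.map hF := rfl
  simp only [h1, ← map_trans]
  exact h.imp (fun h => ⟨key h.1, key h.2⟩) (fun h => ⟨key h.1, key h.2⟩)

/-- Backtrack equivalence of paths: the equivalence relation generated by elementary backtrack
equivalence. -/
def btSetoid (x y : X) : Setoid (PwPath E x y) := Relation.EqvGen.setoid ElemBacktrack

theorem eqvGen_map {α β : Type*} {r : α → α → Prop} {s : β → β → Prop} (f : α → β)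
    (hf : ∀ a b, r a b → s (f a) (f b)) {a b : α} (h : Relation.EqvGen r a b) :
    Relation.EqvGen s (f a) (f b) := by
  induction h with
  | rel _ _ h => exact .rel _ _ (hf _ _ h)
  | refl _ => exact .refl _
  | symm _ _ _ ih => exact .symm _ _ ih
  | trans _ _ _ _ _ ih ih' => exact .trans _ _ _ ih ih'

end PwPath

/-! ### The category of backtrack-erased paths -/

/-- The objects of the category of backtrack-erased piecewise `C¹` paths on a manifold `X`
modelled on `E`: the points of `X`. -/
@[nolint unusedArguments]
def PathCat (_E X : Type*) : Type _ := X

/-- A backtrack-erased path from `x` to `y`: a backtrack equivalence class of paths. -/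
def BtPath (E : Type*) {X : Type*} [NormedAddCommGroup E] [NormedSpace ℝ E]
    [TopologicalSpace X] [ChartedSpace E X] (x y : X) : Type _ :=
  Quotient (PwPath.btSetoid (E := E) x y)

/-- The class of a path. -/
def BtPath.mk {x y : X} (p : PwPath E x y) : BtPath E x y := Quotient.mk _ p

/-- Composition of backtrack-erased paths: the class of the concatenation. -/
def BtPath.trans {x y z : X} (p : BtPath E x y) (q : BtPath E y z) : BtPath E x z :=
  Quotient.map₂ PwPath.trans (fun _ b h c _ h' => Relation.EqvGen.trans _ _ _
    (PwPath.eqvGen_map (fun p => PwPath.trans p c) (fun _ _ h => h.trans_left c) h)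
    (PwPath.eqvGen_map (fun p => PwPath.trans b p) (fun _ _ h => h.trans_right b) h')) p q

/-- The image of a backtrack-erased path under a `C¹` map. -/
def BtPath.map {E' Y : Type*} [NormedAddCommGroup E'] [NormedSpace ℝ E']
    [TopologicalSpace Y] [ChartedSpace E' Y] {F : X → Y} (hF : ContMDiff 𝓘(ℝ, E) 𝓘(ℝ, E') 1 F)
    {x y : X} (p : BtPath E x y) : BtPath E' (F x) (F y) :=
  Quotient.map (PwPath.map hF) (fun _ _ h => PwPath.eqvGen_map _ (fun _ _ h => h.map hF) h) p

/-- The category of backtrack-erased paths on `X`. -/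
instance : Category (PathCat E X) where
  Hom x y := BtPath E (X := X) x y
  id x := BtPath.mk (PwPath.refl E (X := X) x)
  comp p q := BtPath.trans p q
  id_comp p := by
    induction p using Quotient.inductionOn with
    | h p => exact Quotient.sound (.rel _ _ (.of_isReparam (PwPath.isReparam_refl_trans p)))
  comp_id p := by
    induction p using Quotient.inductionOn with
    | h p => exact Quotient.sound (.rel _ _ (.of_isReparam (PwPath.isReparam_trans_refl p)))
  assoc p q r := by
    induction p using Quotient.inductionOn with
    | h p =>
      induction q using Quotient.inductionOn with
      | h q =>
        induction r using Quotient.inductionOn with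
        | h r => exact congrArg BtPath.mk (PwPath.trans_assoc p q r)

/-- The functor on categories of backtrack-erased paths induced by a `C¹` map. -/
def PathCat.map {E' Y : Type*} [NormedAddCommGroup E'] [NormedSpace ℝ E']
    [TopologicalSpace Y] [ChartedSpace E' Y] {F : X → Y} (hF : ContMDiff 𝓘(ℝ, E) 𝓘(ℝ, E') 1 F) :
    PathCat E X ⥤ PathCat E' Y where
  obj x := F x
  map p := BtPath.map hF p
  map_id _ := rfl
  map_comp p q := by
    induction p using Quotient.inductionOn with
    | h p =>
      induction q using Quotient.inductionOn with
      | h q => exact congrArg BtPath.mk (PwPath.map_trans hF p q)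

end Paths

/-! ### Principal bundles, connections, horizontal paths -/

/-- A smooth principal `G`-bundle `P → M`, with `p g` written as `act p g`. -/
structure PrincipalBundle (EG EP EM G P M : Type*)
    [NormedAddCommGroup EG] [NormedSpace ℝ EG] [NormedAddCommGroup EP] [NormedSpace ℝ EP]
    [NormedAddCommGroup EM] [NormedSpace ℝ EM]
    [TopologicalSpace G] [ChartedSpace EG G] [Group G]
    [TopologicalSpace P] [ChartedSpace EP P] [TopologicalSpace M] [ChartedSpace EM M] where
  proj : P → M
  act : P → G → P
  contMDiff_proj : ContMDiff 𝓘(ℝ, EP) 𝓘(ℝ, EM) ∞ proj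
  proj_surjective : Function.Surjective proj
  contMDiff_act :
    ContMDiff (𝓘(ℝ, EP).prod 𝓘(ℝ, EG)) 𝓘(ℝ, EP) ∞ (fun x : P × G => act x.1 x.2)
  act_one : ∀ p, act p 1 = p
  act_mul : ∀ p g h, act (act p g) h = act p (g * h)
  act_free : ∀ p g, act p g = p → g = 1
  proj_act : ∀ p g, proj (act p g) = proj p
  /-- Every point of `M` has an open neighbourhood `U` with an equivariant diffeomorphism
  `φ : U × G → π⁻¹(U)` over `U`. -/
  locally_trivial : ∀ x : M, ∃ (U : Set M) (φ : PartialEquiv (M × G) P),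
    IsOpen U ∧ x ∈ U ∧ φ.source = U ×ˢ Set.univ ∧ φ.target = proj ⁻¹' U ∧
    ContMDiffOn (𝓘(ℝ, EM).prod 𝓘(ℝ, EG)) 𝓘(ℝ, EP) ∞ φ φ.source ∧
    ContMDiffOn 𝓘(ℝ, EP) (𝓘(ℝ, EM).prod 𝓘(ℝ, EG)) ∞ φ.symm φ.target ∧
    ∀ u ∈ U, ∀ g h : G, proj (φ (u, g)) = u ∧ act (φ (u, g)) h = φ (u, g * h)

section Bundle

variable {EG EP EM G P M : Type*}
  [NormedAddCommGroup EG] [NormedSpace ℝ EG] [NormedAddCommGroup EP] [NormedSpace ℝ EP]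
  [NormedAddCommGroup EM] [NormedSpace ℝ EM]
  [TopologicalSpace G] [ChartedSpace EG G] [Group G]
  [TopologicalSpace P] [ChartedSpace EP P] [TopologicalSpace M] [ChartedSpace EM M]

/-- The right translation by `g` is smooth. -/
theorem PrincipalBundle.contMDiff_translate (B : PrincipalBundle EG EP EM G P M) (g : G) :
    ContMDiff 𝓘(ℝ, EP) 𝓘(ℝ, EP) ∞ (fun p => B.act p g) :=
  B.contMDiff_act.comp (contMDiff_id.prodMk contMDiff_const)

/-- The functor on backtrack-erased paths on `P` given by right translation by `g`. -/
def PrincipalBundle.translate (B : PrincipalBundle EG EP EM G P M) (g : G) :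
    PathCat EP P ⥤ PathCat EP P :=
  PathCat.map ((B.contMDiff_translate g).of_le (by exact_mod_cast le_top))

/-- The functor on backtrack-erased paths given by the projection `P → M`. -/
def PrincipalBundle.projPath (B : PrincipalBundle EG EP EM G P M) :
    PathCat EP P ⥤ PathCat EM M :=
  PathCat.map (B.contMDiff_proj.of_le (by exact_mod_cast le_top))

/-- The adjoint representation of `G` on its Lie algebra: the derivative at `1` of conjugation. -/
def Ad (EG : Type*) {G : Type*} [NormedAddCommGroup EG] [NormedSpace ℝ EG]
    [TopologicalSpace G] [ChartedSpace EG G] [Group G] (g : G) (Y : GroupLieAlgebra 𝓘(ℝ, EG) G) :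
    GroupLieAlgebra 𝓘(ℝ, EG) G :=
  mfderiv 𝓘(ℝ, EG) 𝓘(ℝ, EG) (fun x : G => g * x * g⁻¹) 1 Y

variable [IsManifold 𝓘(ℝ, EP) ∞ P]

/-- A connection form on a principal bundle: a smooth `1`-form on `P` with values in the Lie
algebra of `G`, equivariant, and reproducing the generators of the fundamental vertical vector
fields. The vector at `p` of the fundamental field of `Y` is the derivative at `1` in the
direction `Y` of `g ↦ p g`. -/
structure Connection (B : PrincipalBundle EG EP EM G P M) where
  form : ∀ p : P, TangentSpace 𝓘(ℝ, EP) p →L[ℝ] GroupLieAlgebra 𝓘(ℝ, EG) G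
  contMDiff_form : ContMDiff (M' := EG) (𝓘(ℝ, EP).tangent) 𝓘(ℝ, EG) ∞
    (fun v : TangentBundle 𝓘(ℝ, EP) P => form v.1 v.2)
  equivariant : ∀ (p : P) (g : G) (v : TangentSpace 𝓘(ℝ, EP) p),
    form (B.act p g) (mfderiv 𝓘(ℝ, EP) 𝓘(ℝ, EP) (fun q => B.act q g) p v) = Ad EG g⁻¹ (form p v)
  vertical : ∀ (p : P) (Y : GroupLieAlgebra 𝓘(ℝ, EG) G),
    form (B.act p 1) (mfderiv 𝓘(ℝ, EG) 𝓘(ℝ, EP) (fun g : G => B.act p g) 1 Y) = Y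

variable {B : PrincipalBundle EG EP EM G P M} (A : Connection B)

/-- A piecewise `C¹` path on `P` is horizontal if the connection form vanishes on its velocity,
up to finitely many times. -/
def Connection.IsHorizontalPath {p q : P} (γ : PwPath EP p q) : Prop :=
  ∃ S : Finset ℝ, ∀ t ∈ Set.Ioo 0 γ.len, t ∉ S →
    A.form (γ.toFun t) (mfderiv 𝓘(ℝ, ℝ) 𝓘(ℝ, EP) γ.toFun t (1 : ℝ)) = 0

/-- A backtrack-erased horizontal path: the class of a horizontal path. -/
def Connection.IsHorizontal {p q : PathCat EP P} (f : p ⟶ q) : Prop :=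
  ∃ γ : PwPath EP (X := P) p q, A.IsHorizontalPath γ ∧ BtPath.mk γ = f

theorem Connection.isHorizontal_refl (p : PathCat EP P) : A.IsHorizontal (𝟙 p) :=
  ⟨PwPath.refl EP (X := P) p, ⟨∅, fun _ ht _ => absurd (ht.1.trans ht.2) (lt_irrefl _)⟩, rfl⟩

theorem Connection.IsHorizontal.eqToHom {p q r : PathCat EP P} {f : p ⟶ q}
    (hf : A.IsHorizontal f) (h : q = r) : A.IsHorizontal (f ≫ CategoryTheory.eqToHom h) := by
  subst h
  simpa using hf

theorem Connection.IsHorizontal.trans {p q r : PathCat EP P} {f : p ⟶ q} {g : q ⟶ r}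
    (hf : A.IsHorizontal f) (hg : A.IsHorizontal g) : A.IsHorizontal (f ≫ g) := by
  classical
  obtain ⟨γ, ⟨S, hS⟩, rfl⟩ := hf
  obtain ⟨δ, ⟨S', hS'⟩, rfl⟩ := hg
  refine ⟨γ.trans δ, ⟨S ∪ S'.image (fun s => s + γ.len) ∪ {γ.len}, fun t ht hts => ?_⟩, rfl⟩
  simp only [Finset.mem_union, Finset.mem_image, Finset.mem_singleton, not_or] at hts
  obtain ⟨⟨h1, h2⟩, h3⟩ := hts
  rcases lt_or_gt_of_ne h3 with h | h
  · have he : (γ.trans δ).toFun =ᶠ[nhds t] γ.toFun := by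
      filter_upwards [Iio_mem_nhds h] with s hs
      simp [PwPath.trans, glue, (Set.mem_Iio.1 hs).le]
    rw [he.mfderiv_eq]
    have h0 : (γ.trans δ).toFun t = γ.toFun t := he.eq_of_nhds
    have := hS t ⟨ht.1, h⟩ h1
    rw [← h0] at this
    exact this
  · have he : (γ.trans δ).toFun =ᶠ[nhds t] δ.toFun ∘ (fun s => s - γ.len) := by
      filter_upwards [Ioi_mem_nhds h] with s hs
      simp [PwPath.trans, glue, not_le.2 (Set.mem_Ioi.1 hs)]
    have hlen : t < γ.len + δ.len := ht.2
    have key := hS' (t - γ.len) ⟨by linarith, by linarith⟩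
      (fun hc => h2 ⟨t - γ.len, hc, by ring⟩)
    have h0 : (γ.trans δ).toFun t = δ.toFun (t - γ.len) := he.eq_of_nhds
    rw [he.mfderiv_eq]
    by_cases hd : MDifferentiableAt 𝓘(ℝ, ℝ) 𝓘(ℝ, EP) δ.toFun (t - γ.len)
    · have hsub : HasMFDerivAt 𝓘(ℝ, ℝ) 𝓘(ℝ, ℝ) (fun s : ℝ => s - γ.len) t
          (ContinuousLinearMap.id ℝ ℝ) :=
        ((hasFDerivAt_id t).sub_const γ.len).hasMFDerivAt
      rw [(hd.hasMFDerivAt.comp t hsub).mfderiv]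
      rw [← h0] at key
      exact key
    · have hd' : ¬ MDifferentiableAt 𝓘(ℝ, ℝ) 𝓘(ℝ, EP) (δ.toFun ∘ fun s => s - γ.len) t := by
        intro hc
        apply hd
        have hadd : MDifferentiableAt 𝓘(ℝ, ℝ) 𝓘(ℝ, ℝ) (fun s : ℝ => s + γ.len) (t - γ.len) :=
          (differentiableAt_id.add_const γ.len).mdifferentiableAt
        have hc' : MDifferentiableAt 𝓘(ℝ, ℝ) 𝓘(ℝ, EP) (δ.toFun ∘ fun s => s - γ.len)
            ((fun s : ℝ => s + γ.len) (t - γ.len)) := by simpa using hc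
        have := hc'.comp (t - γ.len) hadd
        simpa [Function.comp_def] using this
      rw [mfderiv_zero_of_not_mdifferentiableAt hd']
      exact map_zero _

theorem Connection.IsHorizontal.translate {p q : PathCat EP P} {f : p ⟶ q}
    (hf : A.IsHorizontal f) (g : G) : A.IsHorizontal ((B.translate g).map f) := by
  obtain ⟨γ, ⟨S, hS⟩, rfl⟩ := hf
  have hs : ∀ g x, MDifferentiableAt 𝓘(ℝ, EP) 𝓘(ℝ, EP) (fun p => B.act p g) x := fun g x =>
    (B.contMDiff_translate g).mdifferentiable (by simp) x
  refine ⟨PwPath.map (E := EP) (X := P) ((B.contMDiff_translate g).of_le (by exact_mod_cast le_top)) γ,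
    ⟨S, fun t ht hts => ?_⟩, rfl⟩
  have key := hS t ht hts
  change A.form (B.act (γ.toFun t) g) (mfderiv 𝓘(ℝ, ℝ) 𝓘(ℝ, EP)
    ((fun p => B.act p g) ∘ γ.toFun) t (1 : ℝ)) = 0
  by_cases hd : MDifferentiableAt 𝓘(ℝ, ℝ) 𝓘(ℝ, EP) γ.toFun t
  · rw [mfderiv_comp t (hs g _) hd]
    have := A.equivariant (γ.toFun t) g (mfderiv 𝓘(ℝ, ℝ) 𝓘(ℝ, EP) γ.toFun t (1 : ℝ))
    rw [key] at this
    exact this.trans (map_zero (mfderiv 𝓘(ℝ, EG) 𝓘(ℝ, EG) (fun x : G => g⁻¹ * x * g⁻¹⁻¹) 1))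
  · have hd' : ¬ MDifferentiableAt 𝓘(ℝ, ℝ) 𝓘(ℝ, EP) ((fun p => B.act p g) ∘ γ.toFun) t := by
      intro hc
      apply hd
      have := (hs g⁻¹ _).comp t hc
      simpa [Function.comp_def, B.act_mul, B.act_one] using this
    rw [mfderiv_zero_of_not_mdifferentiableAt hd']
    exact map_zero _

/-! ### Decorated horizontal paths -/

variable {EH H : Type*} [NormedAddCommGroup EH] [NormedSpace ℝ EH]
  [TopologicalSpace H] [ChartedSpace EH H] [Group H]

/-- The objects of the category of decorated horizontal backtrack-erased paths: the points of
`P`. -/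
@[nolint unusedArguments]
def DecCat (_ : Connection B) (_ : LieCrossedModule EG EH G H) : Type _ := P

/-- A point of `P`, as an object of the category of paths on `P`. -/
def DecCat.toPath {A : Connection B} {X : LieCrossedModule EG EH G H} (p : DecCat A X) :
    PathCat EP P := p

/-- A morphism `p ⟶ q`: a pair `(γ, h)` of a backtrack-erased horizontal path `γ` and an `h : H`
such that `γ` starts at `p` and its end point `t(γ)` satisfies `t(γ) τ(h⁻¹) = q`, which is
`t(γ) = q τ(h)`. -/
@[ext]
structure DecHom {A : Connection B} {X : LieCrossedModule EG EH G H} (p q : DecCat A X) where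
  h : H
  path : p.toPath ⟶ (B.translate (X.τ h)).obj q.toPath
  horizontal : A.IsHorizontal path

variable (X : LieCrossedModule EG EH G H)

theorem translate_obj_one (p : PathCat EP P) : (B.translate 1).obj p = p := B.act_one p

theorem translate_obj_mul (p : PathCat EP P) (g h : G) :
    (B.translate h).obj ((B.translate g).obj p) = (B.translate (g * h)).obj p := B.act_mul p g h

theorem translate_map_one {p q : PathCat EP P} (f : p ⟶ q) :
    (B.translate 1).map f = eqToHom (translate_obj_one (B := B) p) ≫ f ≫
      eqToHom (translate_obj_one (B := B) q).symm := by
  have key : ∀ (F : P → P) (hF : ContMDiff 𝓘(ℝ, EP) 𝓘(ℝ, EP) 1 F) (h : F = id),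
      (PathCat.map hF).map f = eqToHom (X := (PathCat.map hF).obj p) (congrFun h p) ≫ f ≫
        eqToHom (Y := (PathCat.map hF).obj q) (congrFun h q).symm := by
    rintro F hF rfl
    refine Eq.trans ?_ ((Category.id_comp _).trans (Category.comp_id f)).symm
    induction f using Quotient.inductionOn with
    | h f => rfl
  exact key _ _ (funext B.act_one)

theorem translate_map_mul {p q : PathCat EP P} (f : p ⟶ q) (g h : G) :
    (B.translate h).map ((B.translate g).map f) = eqToHom (translate_obj_mul p g h) ≫
      (B.translate (g * h)).map f ≫ eqToHom (translate_obj_mul q g h).symm := by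
  have key : ∀ (F F' : P → P) (hF : ContMDiff 𝓘(ℝ, EP) 𝓘(ℝ, EP) 1 F)
      (hF' : ContMDiff 𝓘(ℝ, EP) 𝓘(ℝ, EP) 1 F') (h : F = F'),
      (PathCat.map hF).map f =
        eqToHom (X := (PathCat.map hF).obj p) (Y := (PathCat.map hF').obj p) (congrFun h p) ≫
          (PathCat.map hF').map f ≫
          eqToHom (X := (PathCat.map hF').obj q) (Y := (PathCat.map hF).obj q)
            (congrFun h q).symm := by
    rintro F F' hF hF' rfl
    exact ((Category.id_comp _).trans (Category.comp_id _)).symm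
  refine Eq.trans ?_ (key (fun p => B.act (B.act p g) h) (fun p => B.act p (g * h))
    (((B.contMDiff_translate h).comp (B.contMDiff_translate g)).of_le (by exact_mod_cast le_top))
    ((B.contMDiff_translate (g * h)).of_le (by exact_mod_cast le_top))
    (funext fun p => B.act_mul p g h))
  induction f using Quotient.inductionOn with
  | h f => rfl

theorem DecHom.ext' {A : Connection B} {X : LieCrossedModule EG EH G H} {p q : DecCat A X}
    {f g : DecHom p q} (h₁ : f.h = g.h)
    (h₂ : f.path ≫ eqToHom (by rw [h₁]) = g.path) : f = g := by
  obtain ⟨h, f, hf⟩ := f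
  obtain ⟨h', g, hg⟩ := g
  dsimp at h₁
  subst h₁
  simp only [eqToHom_refl, Category.comp_id] at h₂
  subst h₂
  rfl

/-- The composite of `(γ₁, h₁)` followed by `(γ₂, h₂)` is `(γ, h₂ h₁)`, where `γ` is `γ₁` followed
by the right translate `γ₂ τ(h₁)`. The arrows `eqToHom` only adjust the endpoints along
equalities such as `(r τ(h₂)) τ(h₁) = r τ(h₂ h₁)`. -/
def DecHom.comp {A : Connection B} {X : LieCrossedModule EG EH G H} {p q r : DecCat A X}
    (f : DecHom p q) (g : DecHom q r) : DecHom p r where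
  h := g.h * f.h
  path := f.path ≫ (B.translate (X.τ f.h)).map g.path ≫
    eqToHom (by rw [translate_obj_mul, map_mul])
  horizontal := f.horizontal.trans A ((g.horizontal.translate A _).eqToHom A _)

/-- The identity of `p` is the constant path decorated with `1`. -/
def DecHom.id {A : Connection B} {X : LieCrossedModule EG EH G H} (p : DecCat A X) :
    DecHom p p where
  h := 1
  path := 𝟙 p.toPath ≫ eqToHom (by rw [map_one, translate_obj_one])
  horizontal := (A.isHorizontal_refl _).eqToHom A _

theorem translate_congr {p q : PathCat EP P} (f : p ⟶ q) {g g' : G} (h : g = g') :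
    (B.translate g).map f = eqToHom (by rw [h]) ≫ (B.translate g').map f ≫
      eqToHom (by rw [h]) := by
  subst h
  simp

/-- The category of horizontal backtrack-erased paths on `P` decorated with elements of `H`. -/
instance : Category (DecCat A X) where
  Hom p q := DecHom p q
  id p := DecHom.id p
  comp f g := DecHom.comp f g
  id_comp f := DecHom.ext' (mul_one f.h) (by
    simp [DecHom.comp, DecHom.id, translate_congr f.path (map_one X.τ), translate_map_one]
    erw [eqToHom_trans, eqToHom_refl, Category.comp_id])
  comp_id f := DecHom.ext' (one_mul f.h) (by
    simp [DecHom.comp, DecHom.id, eqToHom_map]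
    erw [eqToHom_trans, eqToHom_refl, Category.comp_id])
  assoc f g k := DecHom.ext' (mul_assoc k.h g.h f.h).symm (by
    simp [DecHom.comp, eqToHom_map, translate_map_mul,
      translate_congr k.path (map_mul X.τ g.h f.h)]
    erw [eqToHom_trans])

/-- The projection to the base: `p ↦ π(p)` on objects, `(γ, h) ↦ π ∘ γ` on morphisms. -/
def decProj : DecCat A X ⥤q PathCat EM M where
  obj p := B.projPath.obj p.toPath
  map {_ q} f := B.projPath.map f.path ≫ eqToHom (B.proj_act (q : P) (X.τ f.h))

theorem decAct_target (q : DecCat A X) (h : H) {a b : X.Cat} (k : a ⟶ b) :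
    (B.translate a.toGroup).obj ((B.translate (X.τ h)).obj q.toPath) =
      (B.translate (X.τ (X.α a.toGroup⁻¹ (k.1⁻¹ * h)))).obj
        ((B.translate b.toGroup).obj q.toPath) := by
  obtain ⟨k, hk⟩ := k
  change _ = (B.translate (X.τ (X.α a.toGroup⁻¹ (k⁻¹ * h)))).obj _
  rw [translate_obj_mul, translate_obj_mul, X.τ_α, ← hk, map_mul, map_inv]
  congr 2
  group

/-- The action of the categorical group of `(G, H, α, τ)`: `(p, g) ↦ p g` on objects and
`((γ, h), (h₁, g₁)) ↦ (γ g₁, α(g₁⁻¹)(h₁⁻¹ h))` on morphisms. -/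
def decAct : (DecCat A X × X.Cat) ⥤q DecCat A X where
  obj x := (B.translate x.2.toGroup).obj x.1.toPath
  map {x y} f :=
    { h := X.α x.2.toGroup⁻¹ (f.2.1⁻¹ * f.1.h)
      path := (B.translate x.2.toGroup).map f.1.path ≫
        eqToHom (decAct_target A X y.1 f.1.h f.2)
      horizontal := (f.1.horizontal.translate A _).eqToHom A _ }

end Bundle

end CatBundle

end

noncomputable section

namespace CatBundle

open Set Filter Topology

/-! The analytic core is unique horizontal lifting for backtrack-erased paths. A path on `M` has,
from each point over its start, exactly one horizontal lift on its domain
(`Connection.exists_isLift`, `Connection.IsLift.eqOn`). Backtrack equivalent paths have lifts from a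
given point that end at the same point and are backtrack equivalent
(`Connection.exists_isPathLift_of_eqvGen`). Hence a backtrack-erased horizontal path is determined
by its start and its projection. Existence gives surjectivity on morphisms. Uniqueness gives
transitivity over a morphism: translate one path so that it starts where the other does, then solve
for the `H`-component. The rest is algebra: functoriality of the action is the interchange law of
the crossed module, and freeness reduces to freeness on `P` and cancellation in `H`.

Existence of lifts: over a `C¹` curve a local section `σ` becomes horizontal after multiplication by
a curve `g` in `G` with `g' = dR_g ξ` and `ξ = -A(σ')`, because both terms of `A((σ g)')` are then
images under `Ad(g⁻¹)`. The equation is solved locally in a chart by Picard-Lindelöf. Translating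
the resulting lift reaches every starting point over the same interval, so local lifts patch
together by continuous induction.

Uniqueness of lifts: two lifts differ locally by a curve `g` in `G`, and horizontality of both
forces `g' = 0` off a finite set. Thus `g` is locally constant, and it is `1` wherever the lifts
meet.

Backtracks: the lift of `d d⁻¹` is a lift of `d` followed by its own reverse, so it returns to its
start. Lifts of `a d d⁻¹ b` and `a b` therefore share the lifts of `a` and of `b`.
Reparametrizations lift by uniqueness. -/

/-- Continuous induction for a relation between the end points of subintervals of `[a, b]` which
is transitive and holds for all short intervals that have a given end point. -/
theorem interval_induction {Q : ℝ → ℝ → Prop} {a b : ℝ} (hab : a ≤ b)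
    (htrans : ∀ u v w, a ≤ u → u ≤ v → v ≤ w → w ≤ b → Q u v → Q v w → Q u w)
    (hloc : ∀ t ∈ Icc a b, ∃ ε > 0, (∀ u ∈ Icc a b, u ≤ t → t - ε < u → Q u t) ∧
      ∀ v ∈ Icc a b, t ≤ v → v < t + ε → Q t v) : Q a b := by
  set S := {t | t ∈ Icc a b ∧ Q a t} with hS
  have haS : a ∈ S := by
    obtain ⟨ε, hε, h, -⟩ := hloc a ⟨le_rfl, hab⟩
    exact ⟨⟨le_rfl, hab⟩, h a ⟨le_rfl, hab⟩ le_rfl (by linarith)⟩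
  have hbdd : BddAbove S := ⟨b, fun t ht => ht.1.2⟩
  have hs : sSup S ∈ Icc a b := ⟨le_csSup hbdd haS, csSup_le ⟨a, haS⟩ fun t ht => ht.1.2⟩
  obtain ⟨ε, hε, hl, hr⟩ := hloc _ hs
  obtain ⟨t, htS, ht⟩ := exists_lt_of_lt_csSup ⟨a, haS⟩ (sub_lt_self (sSup S) hε)
  have hts : t ≤ sSup S := le_csSup hbdd htS
  have hQ : Q a (sSup S) :=
    htrans a t _ le_rfl htS.1.1 hts hs.2 htS.2 (hl t htS.1 hts ht)
  rcases hs.2.eq_or_lt with h | h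
  · rwa [h] at hQ
  · exfalso
    have h1 : sSup S < min b (sSup S + ε / 2) := lt_min h (by linarith)
    have h2 : min b (sSup S + ε / 2) ∈ Icc a b := ⟨hs.1.trans h1.le, min_le_left _ _⟩
    have h3 := hr _ h2 h1.le ((min_le_right _ _).trans_lt (by linarith))
    exact absurd (le_csSup hbdd ⟨h2, htrans _ _ _ le_rfl hs.1 h1.le h2.2 hQ h3⟩) (not_le.2 h1)

/-! ### Local existence for time-dependent differential equations. -/

/-- Local solutions of `x' = F(x) ξ(t)` for a `C¹` map `F` and a continuous curve `ξ`. -/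
theorem exists_contDiffOn_hasDerivAt_clm_apply {E : Type*} [NormedAddCommGroup E]
    [NormedSpace ℝ E] [CompleteSpace E] {F : E → E →L[ℝ] E} {x₁ : E} (hF : ContDiffAt ℝ 1 F x₁)
    {ξ : ℝ → E} (hξ : Continuous ξ) (t₀ : ℝ) {W : Set E} (hW : W ∈ 𝓝 x₁) :
    ∃ ε > 0, ∃ α : ℝ → E, α t₀ = x₁ ∧ ContDiffOn ℝ 1 α (Ioo (t₀ - ε) (t₀ + ε)) ∧
      ∀ t ∈ Ioo (t₀ - ε) (t₀ + ε), α t ∈ W ∧ HasDerivAt α (F (α t) (ξ t)) t := by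
  obtain ⟨K, s, hs, hK⟩ := hF.exists_lipschitzOnWith
  have hb : ∀ᶠ x in 𝓝 x₁, ‖F x‖ < ‖F x₁‖ + 1 :=
    hF.continuousAt.norm.eventually_lt_const (by linarith)
  obtain ⟨a, ha, hball⟩ := Metric.nhds_basis_closedBall.mem_iff.1 (inter_mem hs hb)
  have hc : ∀ᶠ t in 𝓝 t₀, ‖ξ t‖ < ‖ξ t₀‖ + 1 :=
    hξ.continuousAt.norm.eventually_lt_const (by linarith)
  obtain ⟨δ, hδ, hξδ⟩ := Metric.nhds_basis_closedBall.mem_iff.1 hc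
  set C := ‖ξ t₀‖ + 1
  set D := ‖F x₁‖ + 1
  have hC : 0 < C := by positivity
  have hD : 0 < D := by positivity
  -- The speed is at most `D * C` on the ball of radius `a`, so a solution cannot leave it within
  -- time `a / (D * C)`; `δ` keeps `‖ξ‖` below `C`.
  set ε := min δ (a / (D * C))
  have hε : 0 < ε := lt_min hδ (by positivity)
  have hξC : ∀ t ∈ Icc (t₀ - ε) (t₀ + ε), ‖ξ t‖ ≤ C := fun t ht => by
    have h1 : ε ≤ δ := min_le_left _ _
    refine (hξδ (?_ : t ∈ Metric.closedBall t₀ δ)).le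
    rw [Real.closedBall_eq_Icc]
    exact ⟨by linarith [ht.1], by linarith [ht.2]⟩
  obtain ⟨a', rfl⟩ : ∃ a' : NNReal, (a' : ℝ) = a := ⟨⟨a, ha.le⟩, rfl⟩
  obtain ⟨C', hC'⟩ : ∃ C' : NNReal, (C' : ℝ) = C := ⟨⟨C, hC.le⟩, rfl⟩
  obtain ⟨L', hL'⟩ : ∃ L' : NNReal, (L' : ℝ) = D * C := ⟨⟨D * C, by positivity⟩, rfl⟩
  have hPL : IsPicardLindelof (fun t x => F x (ξ t)) (tmin := t₀ - ε) (tmax := t₀ + ε)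
      ⟨t₀, by linarith, by linarith⟩ x₁ a' 0 L' (K * C') := by
    refine ⟨fun t ht => ?_, fun x _ => ?_, fun t ht x hx => ?_, ?_⟩
    · refine LipschitzOnWith.of_dist_le_mul fun x hx y hy => ?_
      have h1 := (hK.mono fun z hz => (hball hz).1).dist_le_mul x hx y hy
      rw [dist_eq_norm] at h1 ⊢
      rw [← sub_apply]
      calc ‖(F x - F y) (ξ t)‖ ≤ ‖F x - F y‖ * ‖ξ t‖ := ContinuousLinearMap.le_opNorm _ _
        _ ≤ (K * dist x y) * C := by gcongr; exact hξC t ht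
        _ = _ := by push_cast; rw [hC']; ring
    · exact ((F x).continuous.comp hξ).continuousOn
    · rw [hL']
      exact ((F x).le_opNorm _).trans
        (mul_le_mul (hball hx).2.le (hξC t ht) (norm_nonneg _) hD.le)
    · have h1 : ε ≤ a' / (D * C) := min_le_right _ _
      rw [le_div_iff₀ (by positivity)] at h1
      simp only [hL', add_sub_cancel_left, sub_sub_cancel, max_self, NNReal.coe_zero,
        sub_zero]
      linarith
  obtain ⟨α, hα₀, hα⟩ := hPL.exists_eq_forall_mem_Icc_hasDerivWithinAt₀
  replace hα₀ : α t₀ = x₁ := hα₀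
  have hd : ∀ t ∈ Ioo (t₀ - ε) (t₀ + ε), HasDerivAt α (F (α t) (ξ t)) t := fun t ht =>
    (hα t (Ioo_subset_Icc_self ht)).hasDerivAt (Icc_mem_nhds ht.1 ht.2)
  have hcont : ContinuousAt α t₀ := (hd t₀ ⟨by linarith, by linarith⟩).continuousAt
  -- On a smaller interval `α` stays in `W` and where `F` is `C¹`, so its derivative `F (α t) (ξ t)`
  -- is continuous and `α` is `C¹`.
  have hFc : ∀ᶠ x in 𝓝 x₁, ContDiffAt ℝ 1 F x := hF.eventually (by simp)
  rw [← hα₀] at hW hFc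
  obtain ⟨η, hη, hηW⟩ := Metric.nhds_basis_ball.mem_iff.1
    (inter_mem (hcont.eventually_mem hW) (hcont.eventually hFc))
  rw [Real.ball_eq_Ioo] at hηW
  have h1 : min ε η ≤ ε := min_le_left _ _
  have h2 : min ε η ≤ η := min_le_right _ _
  have hsub : Ioo (t₀ - min ε η) (t₀ + min ε η) ⊆ Ioo (t₀ - ε) (t₀ + ε) :=
    Ioo_subset_Ioo (by linarith) (by linarith)
  have hsub' : Ioo (t₀ - min ε η) (t₀ + min ε η) ⊆ Ioo (t₀ - η) (t₀ + η) :=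
    Ioo_subset_Ioo (by linarith) (by linarith)
  refine ⟨min ε η, lt_min hε hη, α, hα₀, ?_, fun t ht => ⟨(hηW (hsub' ht)).1, hd t (hsub ht)⟩⟩
  rw [contDiffOn_one_iff_derivWithin isOpen_Ioo.uniqueDiffOn]
  refine ⟨fun t ht => (hd t (hsub ht)).differentiableAt.differentiableWithinAt, ?_⟩
  refine ContinuousOn.congr (f := fun t => F (α t) (ξ t)) (fun t ht => ?_)
    fun t ht => (derivWithin_of_isOpen isOpen_Ioo ht).trans (hd t (hsub ht)).deriv
  have h3 : ContDiffAt ℝ 1 F (α t) := (hηW (hsub' ht)).2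
  exact ((ContinuousAt.comp h3.continuousAt (hd t (hsub ht)).continuousAt).clm_apply
    hξ.continuousAt).continuousWithinAt

/-! ### Differentials and velocities with values in the model spaces. -/

section Velocity

variable {E X E' Y : Type*} [NormedAddCommGroup E] [NormedSpace ℝ E]
  [TopologicalSpace X] [ChartedSpace E X] [NormedAddCommGroup E'] [NormedSpace ℝ E']
  [TopologicalSpace Y] [ChartedSpace E' Y]

/-- The differential of a map between manifolds, as a map between the model spaces. -/
def tderiv (E E' : Type*) {X Y : Type*} [NormedAddCommGroup E] [NormedSpace ℝ E]
    [TopologicalSpace X] [ChartedSpace E X] [NormedAddCommGroup E'] [NormedSpace ℝ E']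
    [TopologicalSpace Y] [ChartedSpace E' Y] (F : X → Y) (x : X) : E →L[ℝ] E' :=
  mfderiv 𝓘(ℝ, E) 𝓘(ℝ, E') F x

/-- The velocity of a curve in a manifold, as an element of the model space. -/
def velocity (E : Type*) {X : Type*} [NormedAddCommGroup E] [NormedSpace ℝ E]
    [TopologicalSpace X] [ChartedSpace E X] (γ : ℝ → X) (t : ℝ) : E :=
  tderiv ℝ E γ t 1

theorem tderiv_comp {E'' Z : Type*} [NormedAddCommGroup E''] [NormedSpace ℝ E'']
    [TopologicalSpace Z] [ChartedSpace E'' Z] {F : Y → Z} {f : X → Y} {x : X}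
    (hF : MDifferentiableAt 𝓘(ℝ, E') 𝓘(ℝ, E'') F (f x))
    (hf : MDifferentiableAt 𝓘(ℝ, E) 𝓘(ℝ, E') f x) :
    tderiv E E'' (fun x => F (f x)) x = (tderiv E' E'' F (f x)).comp (tderiv E E' f x) :=
  mfderiv_comp x hF hf

theorem tderiv_congr {F F' : X → Y} {x : X} (h : F =ᶠ[𝓝 x] F') :
    tderiv E E' F x = tderiv E E' F' x := h.mfderiv_eq

theorem velocity_comp {F : X → Y} {γ : ℝ → X} {t : ℝ}
    (hF : MDifferentiableAt 𝓘(ℝ, E) 𝓘(ℝ, E') F (γ t))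
    (hγ : MDifferentiableAt 𝓘(ℝ, ℝ) 𝓘(ℝ, E) γ t) :
    velocity E' (fun t => F (γ t)) t = tderiv E E' F (γ t) (velocity E γ t) := by
  rw [velocity, tderiv_comp hF hγ]
  rfl

theorem velocity_congr {γ γ' : ℝ → X} {t : ℝ} (h : γ =ᶠ[𝓝 t] γ') :
    velocity E γ t = velocity E γ' t := by rw [velocity, tderiv_congr h]; rfl

theorem velocity_eq_deriv {x : ℝ → E} {x' : E} {t : ℝ} (h : HasDerivAt x x' t) :
    velocity E x t = x' := by
  rw [velocity, tderiv, mfderiv_eq_fderiv]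
  exact h.deriv

theorem tderiv_id {x : X} : tderiv E E (fun x : X => x) x = ContinuousLinearMap.id ℝ E :=
  mfderiv_id

end Velocity

/-! ### The right-translation equation on a Lie group. -/

section LieGroupODE

variable {EG G : Type*} [NormedAddCommGroup EG] [NormedSpace ℝ EG]
  [TopologicalSpace G] [ChartedSpace EG G] [Group G] [LieGroup 𝓘(ℝ, EG) ∞ G]

theorem mdifferentiable_mul_right (g : G) :
    MDifferentiable 𝓘(ℝ, EG) 𝓘(ℝ, EG) (fun y : G => y * g) :=
  (contMDiff_mul_right (I := 𝓘(ℝ, EG)) (n := ∞) (a := g)).mdifferentiable (by simp)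

theorem mdifferentiable_mul_left (g : G) :
    MDifferentiable 𝓘(ℝ, EG) 𝓘(ℝ, EG) (fun y : G => g * y) :=
  (contMDiff_mul_left (I := 𝓘(ℝ, EG)) (n := ∞) (a := g)).mdifferentiable (by simp)

/-- Local solutions of the equation `g' = dR_g ξ(t)` on a Lie group. -/
theorem exists_velocity_eq_tderiv_mul_right [CompleteSpace EG] {ξ : ℝ → EG} (hξ : Continuous ξ) (t₀ : ℝ) :
    ∃ ε > 0, ∃ g : ℝ → G, g t₀ = 1 ∧
      ContMDiffOn 𝓘(ℝ, ℝ) 𝓘(ℝ, EG) 1 g (Ioo (t₀ - ε) (t₀ + ε)) ∧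
      ∀ t ∈ Ioo (t₀ - ε) (t₀ + ε),
        velocity EG g t = tderiv EG EG (fun y : G => y * g t) 1 (ξ t) := by
  have : IsManifold 𝓘(ℝ, EG) ∞ G := LieGroup.toContMDiffMul.toIsManifold
  set e := extChartAt 𝓘(ℝ, EG) (1 : G) with he
  set x₁ := e 1
  have he1 : e.symm x₁ = 1 := extChartAt_to_inv (I := 𝓘(ℝ, EG)) (1 : G)
  have hopen : IsOpen e.target := isOpen_extChartAt_target (I := 𝓘(ℝ, EG)) (1 : G)
  have hx₁ : x₁ ∈ e.target := mem_extChartAt_target (I := 𝓘(ℝ, EG)) (1 : G)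
  have hes : ContMDiffOn 𝓘(ℝ, EG) 𝓘(ℝ, EG) ∞ e.symm e.target := contMDiffOn_extChartAt_symm _
  have hesAt : ∀ x ∈ e.target, ContMDiffAt 𝓘(ℝ, EG) 𝓘(ℝ, EG) ∞ e.symm x := fun x hx =>
    hes.contMDiffAt (hopen.mem_nhds hx)
  have heAt : ∀ y ∈ e.source, ContMDiffAt 𝓘(ℝ, EG) 𝓘(ℝ, EG) ∞ e y := fun y hy =>
    contMDiffAt_extChartAt' (by simpa [he, extChartAt_source] using hy)
  have h1s : (1 : G) ∈ e.source := mem_extChartAt_source (I := 𝓘(ℝ, EG)) (1 : G)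
  have hsrc : IsOpen e.source := isOpen_extChartAt_source (I := 𝓘(ℝ, EG)) (1 : G)
  -- Multiplication in the chart at `1`. Its partial differential in the first variable at `x₁` is
  -- `dR_g` in coordinates, so the equation becomes `x' = F(x) (de₁ ξ)`.
  let μ : EG × EG → EG := fun z => e (e.symm z.1 * e.symm z.2)
  have hμ : ∀ x ∈ e.target, ContDiffAt ℝ ∞ μ (x₁, x) := fun x hx => by
    rw [← contMDiffAt_iff_contDiffAt]
    have h1 : ContMDiffAt 𝓘(ℝ, EG × EG) 𝓘(ℝ, EG) ∞
        (fun z : EG × EG => e.symm z.1 * e.symm z.2) (x₁, x) :=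
      ((hesAt x₁ hx₁).comp (x₁, x) contDiffAt_fst.contMDiffAt).mul
        ((hesAt x hx).comp (x₁, x) contDiffAt_snd.contMDiffAt)
    refine ContMDiffAt.comp (x₁, x) (heAt _ ?_) h1
    change e.symm x₁ * e.symm x ∈ e.source
    rw [he1, one_mul]
    exact e.map_target hx
  -- Restricting the full differential of `μ`, rather than differentiating each slice, makes the
  -- regularity of `F` in `x` visible.
  let F : EG → EG →L[ℝ] EG := fun x => (fderiv ℝ μ (x₁, x)).comp (.inl ℝ EG EG)
  have hF : ContDiffAt ℝ 1 F x₁ := by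
    have h1 : ContDiffAt ℝ 1 (fderiv ℝ μ) (x₁, x₁) :=
      (hμ x₁ hx₁).fderiv_right (m := ∞) le_rfl |>.of_le (by exact_mod_cast le_top)
    have h2 : ContDiffAt ℝ 1 (fun x : EG => (x₁, x)) x₁ := contDiffAt_const.prodMk contDiffAt_id
    exact (ContDiffAt.comp x₁ h1 h2).clm_comp contDiffAt_const
  have hFx : ∀ x ∈ e.target, F x = fderiv ℝ (fun y => μ (y, x)) x₁ := fun x hx => by
    have h1 : HasFDerivAt (fun y : EG => (y, x)) (.inl ℝ EG EG) x₁ := hasFDerivAt_prodMk_left x₁ x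
    exact (HasFDerivAt.comp x₁ ((hμ x hx).differentiableAt (by simp)).hasFDerivAt h1).fderiv.symm
  obtain ⟨ε, hε, α, hα₀, hα, hd⟩ := exists_contDiffOn_hasDerivAt_clm_apply hF
    ((tderiv EG EG e 1).continuous.comp hξ) t₀ (hopen.mem_nhds hx₁)
  refine ⟨ε, hε, fun t => e.symm (α t), (congrArg e.symm hα₀).trans he1, ?_, fun t ht => ?_⟩
  · exact (hes.of_le (by exact_mod_cast le_top)).comp hα.contMDiffOn fun t ht => (hd t ht).1
  · obtain ⟨hx, hdx⟩ := hd t ht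
    have hmd : ∀ x ∈ e.target, MDifferentiableAt 𝓘(ℝ, EG) 𝓘(ℝ, EG) e.symm x := fun x hx =>
      (hesAt x hx).mdifferentiableAt (by simp)
    have hR : MDifferentiableAt 𝓘(ℝ, EG) 𝓘(ℝ, EG) (fun y : G => y * e.symm (α t)) (e.symm x₁) :=
      mdifferentiable_mul_right _ _
    have hRe : MDifferentiableAt 𝓘(ℝ, EG) 𝓘(ℝ, EG) (fun y => e.symm y * e.symm (α t)) x₁ :=
      hR.comp x₁ (hmd x₁ hx₁)
    have h1x : e.symm x₁ * e.symm (α t) = e.symm (α t) := by rw [he1, one_mul]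
    have hμx : MDifferentiableAt 𝓘(ℝ, EG) 𝓘(ℝ, EG) (fun y => μ (y, α t)) x₁ :=
      MDifferentiableAt.comp x₁ ((heAt _ (by rw [h1x]; exact e.map_target hx)).mdifferentiableAt
        (by simp)) hRe
    have hμv : μ (x₁, α t) = α t := by
      change e (e.symm x₁ * e.symm (α t)) = α t
      rw [h1x, e.right_inv hx]
    have hinv : tderiv EG EG e.symm x₁ (tderiv EG EG e 1 (ξ t)) = ξ t := by
      have h1 := tderiv_comp (hmd (e 1) hx₁) ((heAt 1 h1s).mdifferentiableAt (by simp))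
      have h2 : (fun x => e.symm (e x)) =ᶠ[𝓝 (1 : G)] fun x => x := by
        filter_upwards [hsrc.mem_nhds h1s] with y hy using e.left_inv hy
      rw [tderiv_congr h2, tderiv_id] at h1
      exact (congrArg (fun L : EG →L[ℝ] EG => L (ξ t)) h1).symm
    -- Near `x₁` the map `e.symm` carries `μ (·, α t)` to right multiplication by `e.symm (α t)`;
    -- this is the differential of that identity.
    have hchain : (tderiv EG EG e.symm (α t)).comp (tderiv EG EG (fun y => μ (y, α t)) x₁) =
        (tderiv EG EG (fun y : G => y * e.symm (α t)) 1).comp (tderiv EG EG e.symm x₁) := by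
      have h1 := tderiv_comp (by rw [hμv]; exact hmd _ hx) hμx
      rw [hμv] at h1
      rw [← h1]
      have h2 := tderiv_comp hR (hmd x₁ hx₁)
      rw [he1] at h2
      rw [← h2]
      refine tderiv_congr ?_
      have h3 : ∀ᶠ y in 𝓝 x₁, e.symm y * e.symm (α t) ∈ e.source :=
        hRe.continuousAt.eventually_mem
          (hsrc.mem_nhds (by rw [h1x]; exact e.map_target hx))
      filter_upwards [h3] with y hy using e.left_inv hy
    rw [velocity_comp (hmd _ hx) hdx.differentiableAt.mdifferentiableAt, velocity_eq_deriv hdx,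
      hFx _ hx]
    have h4 : fderiv ℝ (fun y => μ (y, α t)) x₁ = tderiv EG EG (fun y => μ (y, α t)) x₁ :=
      mfderiv_eq_fderiv.symm
    rw [h4]
    have h5 := congrArg (fun L : EG →L[ℝ] EG => L (tderiv EG EG e 1 (ξ t))) hchain
    simp only [ContinuousLinearMap.comp_apply, hinv] at h5
    exact h5

end LieGroupODE

/-! ### Piecewise `C¹` curves: joining and local regularity. -/

section Concatenation

variable {E X : Type*} [NormedAddCommGroup E] [NormedSpace ℝ E]
  [TopologicalSpace X] [ChartedSpace E X]

/-- The curve that agrees with `f` up to time `v` and with `g` afterwards. -/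
def switch {X : Type*} (v : ℝ) (f g : ℝ → X) (t : ℝ) : X := if t ≤ v then f t else g t

theorem switch_of_le {v t : ℝ} {f g : ℝ → X} (h : t ≤ v) : switch v f g t = f t := if_pos h

theorem switch_of_ge {v t : ℝ} {f g : ℝ → X} (hv : f v = g v) (h : v ≤ t) :
    switch v f g t = g t := by
  rcases h.eq_or_lt with rfl | h
  · rw [switch_of_le le_rfl, hv]
  · exact if_neg (not_le.2 h)

theorem PiecewiseC1.mono {f : ℝ → X} {a b a' b' : ℝ} (hf : PiecewiseC1 E f a b) (ha : a ≤ a')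
    (hb : b' ≤ b) : PiecewiseC1 E f a' b' := by
  obtain ⟨S, hS⟩ := hf
  exact ⟨S, fun u v hu hv hs => hS u v (ha.trans hu) (hv.trans hb) hs⟩

theorem PiecewiseC1.of_contMDiffOn {f : ℝ → X} {a b : ℝ}
    (hf : ContMDiffOn 𝓘(ℝ, ℝ) 𝓘(ℝ, E) 1 f (Icc a b)) : PiecewiseC1 E f a b :=
  ⟨∅, fun _ _ hu hv _ => hf.mono (Icc_subset_Icc hu hv)⟩

theorem PiecewiseC1.switch {f g : ℝ → X} {a v b : ℝ} (hf : PiecewiseC1 E f a v)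
    (hg : PiecewiseC1 E g v b) (h : f v = g v) :
    PiecewiseC1 E (CatBundle.switch v f g) a b := by
  classical
  obtain ⟨S, hS⟩ := hf
  obtain ⟨S', hS'⟩ := hg
  refine ⟨S ∪ S' ∪ {v}, fun u w hu hw hs => ?_⟩
  have hv : v ∉ Ioo u w := hs v (by simp)
  rcases le_or_gt w v with hwv | hwv
  · exact (hS u w hu hwv fun s hs' => hs s (by simp [hs'])).congr fun t ht =>
      switch_of_le (ht.2.trans hwv)
  · have hvu : v ≤ u := not_lt.1 fun hc => hv ⟨hc, hwv⟩
    exact (hS' u w hvu hw fun s hs' => hs s (by simp [hs'])).congr fun t ht =>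
      switch_of_ge h (hvu.trans ht.1)

/-- Apart from finitely many times, a piecewise `C¹` curve is differentiable. -/
theorem PiecewiseC1.exists_mdifferentiableAt {f : ℝ → X} {a b : ℝ} (hf : PiecewiseC1 E f a b) :
    ∃ S : Finset ℝ, ∀ t ∈ Ioo a b, t ∉ S → MDifferentiableAt 𝓘(ℝ, ℝ) 𝓘(ℝ, E) f t := by
  obtain ⟨S, hS⟩ := hf
  refine ⟨S, fun t ht hts => ?_⟩
  have h : (↑S : Set ℝ)ᶜ ∩ Ioo a b ∈ 𝓝 t :=
    inter_mem (S.finite_toSet.isClosed.isOpen_compl.mem_nhds (by simpa using hts))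
      (Ioo_mem_nhds ht.1 ht.2)
  obtain ⟨ε, hε, hsub⟩ := Metric.nhds_basis_closedBall.mem_iff.1 h
  rw [Real.closedBall_eq_Icc] at hsub
  have h1 := (hsub (left_mem_Icc.2 (by linarith))).2.1
  have h2 := (hsub (right_mem_Icc.2 (by linarith))).2.2
  exact ((hS (t - ε) (t + ε) h1.le h2.le fun s hs hs' =>
    (hsub (Ioo_subset_Icc_self hs')).1 hs).contMDiffAt
      (Icc_mem_nhds (by linarith) (by linarith))).mdifferentiableAt (by simp)

/-- A piecewise `C¹` curve is `C¹` on short intervals on either side of any time. -/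
theorem PiecewiseC1.exists_contMDiffOn_nhds {f : ℝ → X} {a b : ℝ} (hf : PiecewiseC1 E f a b)
    (t : ℝ) : ∃ ε > 0,
      (∀ u v, a ≤ u → v ≤ b → t ≤ u → v < t + ε →
        ContMDiffOn 𝓘(ℝ, ℝ) 𝓘(ℝ, E) 1 f (Icc u v)) ∧
      ∀ u v, a ≤ u → v ≤ b → t - ε < u → v ≤ t →
        ContMDiffOn 𝓘(ℝ, ℝ) 𝓘(ℝ, E) 1 f (Icc u v) := by
  classical
  obtain ⟨S, hS⟩ := hf
  -- The time `t` may itself be a break point, but it is never interior to an interval lying on one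
  -- side of it.
  have h : (↑(S.erase t) : Set ℝ)ᶜ ∈ 𝓝 t :=
    (S.erase t).finite_toSet.isClosed.isOpen_compl.mem_nhds (by simp)
  obtain ⟨ε, hε, hsub⟩ := Metric.nhds_basis_ball.mem_iff.1 h
  rw [Real.ball_eq_Ioo] at hsub
  refine ⟨ε, hε, fun u v hu hv h1 h2 => hS u v hu hv fun s hs hsu => ?_,
    fun u v hu hv h1 h2 => hS u v hu hv fun s hs hsu => ?_⟩
  · exact hsub (a := s) ⟨by linarith [hsu.1], by linarith [hsu.2]⟩
      (by simp [hs, (by linarith [hsu.1] : t < s).ne'])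
  · exact hsub (a := s) ⟨by linarith [hsu.1], by linarith [hsu.2]⟩
      (by simp [hs, (by linarith [hsu.2] : s < t).ne])

end Concatenation

/-! ### The connection form along curves, and horizontal lifts. -/

section Bundle

variable {EG EP EM G P M : Type*}
  [NormedAddCommGroup EG] [NormedSpace ℝ EG] [NormedAddCommGroup EP] [NormedSpace ℝ EP]
  [NormedAddCommGroup EM] [NormedSpace ℝ EM]
  [TopologicalSpace G] [ChartedSpace EG G] [Group G]
  [TopologicalSpace P] [ChartedSpace EP P] [TopologicalSpace M] [ChartedSpace EM M]

theorem PrincipalBundle.mdifferentiable_translate (B : PrincipalBundle EG EP EM G P M) (g : G) :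
    MDifferentiable 𝓘(ℝ, EP) 𝓘(ℝ, EP) (fun p => B.act p g) :=
  (B.contMDiff_translate g).mdifferentiable (by simp)

theorem PrincipalBundle.mdifferentiable_orbit [IsManifold 𝓘(ℝ, EG) ∞ G]
    (B : PrincipalBundle EG EP EM G P M) (p : P) :
    MDifferentiable 𝓘(ℝ, EG) 𝓘(ℝ, EP) (fun g => B.act p g) :=
  (B.contMDiff_act.comp (contMDiff_const.prodMk contMDiff_id)).mdifferentiable (by simp)

theorem PrincipalBundle.act_inv_act (B : PrincipalBundle EG EP EM G P M) (p : P) (g : G) :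
    B.act (B.act p g) g⁻¹ = p := by rw [B.act_mul, mul_inv_cancel, B.act_one]

/-- The structure group acts transitively on the fibers. -/
theorem PrincipalBundle.exists_act_eq (B : PrincipalBundle EG EP EM G P M) {p q : P}
    (h : B.proj p = B.proj q) : ∃ g, B.act p g = q := by
  obtain ⟨U, φ, -, hxU, hsrc, htgt, -, -, hφ⟩ := B.locally_trivial (B.proj p)
  have key : ∀ r, B.proj r = B.proj p → ∃ k, φ (B.proj p, k) = r := fun r hr => by
    have hrt : r ∈ φ.target := by rw [htgt]; exact (by rwa [hr] : B.proj r ∈ U)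
    have h1 := φ.map_target hrt
    rw [hsrc] at h1
    have h2 := (hφ _ h1.1 (φ.symm r).2 1).1
    rw [φ.right_inv hrt, hr] at h2
    exact ⟨(φ.symm r).2, by rw [h2]; exact φ.right_inv hrt⟩
  obtain ⟨k, hk⟩ := key p rfl
  obtain ⟨l, hl⟩ := key q h.symm
  exact ⟨k⁻¹ * l, by rw [← hk, (hφ _ hxU k _).2, mul_inv_cancel_left, hl]⟩

/-- The product rule: the differential of the action on `P × G` is the sum of its two partial
differentials. -/
theorem PrincipalBundle.velocity_act (B : PrincipalBundle EG EP EM G P M) {γ : ℝ → P}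
    {g : ℝ → G} {t : ℝ} (hγ : MDifferentiableAt 𝓘(ℝ, ℝ) 𝓘(ℝ, EP) γ t)
    (hg : MDifferentiableAt 𝓘(ℝ, ℝ) 𝓘(ℝ, EG) g t) :
    velocity EP (fun t => B.act (γ t) (g t)) t =
      tderiv EP EP (fun p => B.act p (g t)) (γ t) (velocity EP γ t) +
        tderiv EG EP (fun k => B.act (γ t) k) (g t) (velocity EG g t) := by
  have hact : MDifferentiableAt (𝓘(ℝ, EP).prod 𝓘(ℝ, EG)) 𝓘(ℝ, EP)
      (fun x : P × G => B.act x.1 x.2) (γ t, g t) :=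
    B.contMDiff_act.mdifferentiable (by simp) _
  have h1 := mfderiv_comp t hact (hγ.prodMk hg)
  have h2 := hγ.mfderiv_prod hg
  have h3 := mfderiv_prod_eq_add_apply (v := (velocity EP γ t, velocity EG g t)) hact
  rw [h2] at h1
  refine Eq.trans ?_ h3
  exact congrArg (fun L : ℝ →L[ℝ] EP => L 1) h1

variable [IsManifold 𝓘(ℝ, EP) ∞ P] {B : PrincipalBundle EG EP EM G P M} (A : Connection B)

/-- The connection form at a point, as a linear map between the model spaces. -/
def Connection.formAt (p : P) : EP →L[ℝ] EG := A.form p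

/-- All tangent spaces are definitionally the model space, so in this form base points can be
rewritten along equations such as `act p 1 = p`. -/
theorem Connection.formAt_translate (p : P) (g : G) (v : EP) :
    A.formAt (B.act p g) (tderiv EP EP (fun q => B.act q g) p v) =
      tderiv EG EG (fun x : G => g⁻¹ * x * g⁻¹⁻¹) 1 (A.formAt p v) := A.equivariant p g v

theorem Connection.formAt_tderiv_orbit (p : P) (Y : EG) :
    A.formAt (B.act p 1) (tderiv EG EP (fun g : G => B.act p g) 1 Y) = Y := A.vertical p Y

variable [LieGroup 𝓘(ℝ, EG) ∞ G]

/-- Since `p (g k) = (p g) k`, the vector is the fundamental vertical vector of `Y` at `p g`. -/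
theorem Connection.formAt_tderiv_mul_left (p : P) (g : G) (Y : EG) :
    A.formAt (B.act p g) (tderiv EG EP (fun k => B.act p k) g
      (tderiv EG EG (fun y : G => g * y) 1 Y)) = Y := by
  have hG : IsManifold 𝓘(ℝ, EG) ∞ G := LieGroup.toContMDiffMul.toIsManifold
  have h1 : tderiv EG EP (fun k => B.act (B.act p g) k) 1 =
      (tderiv EG EP (fun k => B.act p k) g).comp (tderiv EG EG (fun y : G => g * y) 1) := by
    have h2 := tderiv_comp (B.mdifferentiable_orbit p (g * 1)) (mdifferentiable_mul_left g 1)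
    rw [mul_one] at h2
    rw [← h2]
    simp only [B.act_mul]
  have h3 := A.formAt_tderiv_orbit (B.act p g) Y
  rw [h1, B.act_one] at h3
  exact h3

/-- Since `p (k g) = (p k) g`, the vector is the right translate by `g` of the fundamental vertical
vector of `Y` at `p`, and equivariance applies. -/
theorem Connection.formAt_tderiv_mul_right (p : P) (g : G) (Y : EG) :
    A.formAt (B.act p g) (tderiv EG EP (fun k => B.act p k) g
      (tderiv EG EG (fun y : G => y * g) 1 Y)) =
      tderiv EG EG (fun x : G => g⁻¹ * x * g⁻¹⁻¹) 1 Y := by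
  have hG : IsManifold 𝓘(ℝ, EG) ∞ G := LieGroup.toContMDiffMul.toIsManifold
  have h1 : (tderiv EP EP (fun q => B.act q g) p).comp (tderiv EG EP (fun k => B.act p k) 1) =
      (tderiv EG EP (fun k => B.act p k) g).comp (tderiv EG EG (fun y : G => y * g) 1) := by
    have h2 := tderiv_comp (f := fun y : G => y * g) (B.mdifferentiable_orbit p (1 * g))
      (mdifferentiable_mul_right g 1)
    have h3 := tderiv_comp (B.mdifferentiable_translate g _) (B.mdifferentiable_orbit p 1)
    rw [one_mul] at h2
    rw [B.act_one] at h3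
    rw [← h2, ← h3]
    simp only [B.act_mul]
  have h4 := A.formAt_translate p g (tderiv EG EP (fun k => B.act p k) 1 Y)
  have h5 := A.formAt_tderiv_orbit p Y
  rw [B.act_one] at h5
  rw [h5] at h4
  rw [← h4]
  exact congrArg (fun L : EG →L[ℝ] EP => A.formAt (B.act p g) (L Y)) h1.symm

/-- The connection form vanishes on the velocity of a curve, up to finitely many times. -/
def Connection.IsHorizontalOn (γ : ℝ → P) (a b : ℝ) : Prop :=
  ∃ S : Finset ℝ, ∀ t ∈ Ioo a b, t ∉ S → A.formAt (γ t) (velocity EP γ t) = 0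

theorem Connection.formAt_velocity_congr {γ γ' : ℝ → P} {t : ℝ} (h : γ' =ᶠ[𝓝 t] γ)
    (h0 : A.formAt (γ t) (velocity EP γ t) = 0) : A.formAt (γ' t) (velocity EP γ' t) = 0 := by
  rw [velocity_congr h, h.eq_of_nhds, h0]

variable {A}

theorem Connection.IsHorizontalOn.congr {γ γ' : ℝ → P} {a b : ℝ} (h : A.IsHorizontalOn γ a b)
    (he : EqOn γ' γ (Ioo a b)) : A.IsHorizontalOn γ' a b := by
  obtain ⟨S, hS⟩ := h
  exact ⟨S, fun t ht hts => A.formAt_velocity_congr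
    (he.eventuallyEq_of_mem (Ioo_mem_nhds ht.1 ht.2)) (hS t ht hts)⟩

theorem Connection.IsHorizontalOn.switch {γ γ' : ℝ → P} {a v b : ℝ}
    (h : A.IsHorizontalOn γ a v) (h' : A.IsHorizontalOn γ' v b) :
    A.IsHorizontalOn (CatBundle.switch v γ γ') a b := by
  classical
  obtain ⟨S, hS⟩ := h
  obtain ⟨S', hS'⟩ := h'
  refine ⟨S ∪ S' ∪ {v}, fun t ht hts => ?_⟩
  simp only [Finset.mem_union, Finset.mem_singleton, not_or] at hts
  obtain ⟨⟨h1, h2⟩, h3⟩ := hts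
  rcases lt_or_gt_of_ne h3 with h | h
  · refine A.formAt_velocity_congr ?_ (hS t ⟨ht.1, h⟩ h1)
    filter_upwards [Iio_mem_nhds h] with s hs using if_pos (le_of_lt hs)
  · refine A.formAt_velocity_congr ?_ (hS' t ⟨h, ht.2⟩ h2)
    filter_upwards [Ioi_mem_nhds h] with s hs using if_neg (not_le.2 hs)

theorem Connection.IsHorizontalOn.translate {γ : ℝ → P} {a b : ℝ} (h : A.IsHorizontalOn γ a b)
    (hγ : PiecewiseC1 EP γ a b) (g : G) : A.IsHorizontalOn (fun t => B.act (γ t) g) a b := by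
  classical
  obtain ⟨S, hS⟩ := h
  obtain ⟨S', hS'⟩ := hγ.exists_mdifferentiableAt
  refine ⟨S ∪ S', fun t ht hts => ?_⟩
  simp only [Finset.mem_union, not_or] at hts
  rw [velocity_comp (B.mdifferentiable_translate g _) (hS' t ht hts.2), A.formAt_translate,
    hS t ht hts.1, map_zero]

variable (A)

/-- The curve `γ` on `P` is a horizontal lift of the curve `c` on `[a, b]`. -/
structure Connection.IsLift (c : ℝ → M) (γ : ℝ → P) (a b : ℝ) : Prop where
  piecewiseC1 : PiecewiseC1 EP γ a b
  horizontal : A.IsHorizontalOn γ a b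
  proj_eq : ∀ t ∈ Icc a b, B.proj (γ t) = c t

variable {A}

theorem Connection.IsLift.translate {c : ℝ → M} {γ : ℝ → P} {a b : ℝ} (h : A.IsLift c γ a b)
    (g : G) : A.IsLift c (fun t => B.act (γ t) g) a b where
  piecewiseC1 := h.piecewiseC1.comp (F := fun p => B.act p g)
    ((B.contMDiff_translate g).of_le (by exact_mod_cast le_top))
  horizontal := h.horizontal.translate h.piecewiseC1 g
  proj_eq t ht := (B.proj_act _ g).trans (h.proj_eq t ht)

theorem Connection.IsLift.switch {c : ℝ → M} {γ γ' : ℝ → P} {a v b : ℝ} (h : A.IsLift c γ a v)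
    (h' : A.IsLift c γ' v b) (hv : γ v = γ' v) :
    A.IsLift c (CatBundle.switch v γ γ') a b where
  piecewiseC1 := h.piecewiseC1.switch h'.piecewiseC1 hv
  horizontal := h.horizontal.switch h'.horizontal
  proj_eq t ht := by
    rcases le_total t v with htv | htv
    · rw [switch_of_le htv, h.proj_eq t ⟨ht.1, htv⟩]
    · rw [switch_of_ge hv htv, h'.proj_eq t ⟨htv, ht.2⟩]

theorem Connection.IsLift.congr {c c' : ℝ → M} {γ γ' : ℝ → P} {a b : ℝ} (h : A.IsLift c γ a b)
    (hc : EqOn c' c (Icc a b)) (hγ : EqOn γ' γ (Icc a b)) : A.IsLift c' γ' a b where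
  piecewiseC1 := h.piecewiseC1.congr hγ
  horizontal := h.horizontal.congr (hγ.mono Ioo_subset_Icc_self)
  proj_eq t ht := by rw [hγ ht, hc ht, h.proj_eq t ht]

end Bundle

/-! ### Existence of horizontal lifts. -/

section Lift

variable {EG EP EM G P M : Type*}
  [NormedAddCommGroup EG] [NormedSpace ℝ EG] [NormedAddCommGroup EP] [NormedSpace ℝ EP]
  [NormedAddCommGroup EM] [NormedSpace ℝ EM]
  [TopologicalSpace G] [ChartedSpace EG G] [Group G]
  [TopologicalSpace P] [ChartedSpace EP P] [TopologicalSpace M] [ChartedSpace EM M]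
  [IsManifold 𝓘(ℝ, EP) ∞ P] {B : PrincipalBundle EG EP EM G P M} {A : Connection B}

/-- On a `C¹` curve, the connection form of the velocity is a continuous function of time. -/
theorem Connection.exists_continuous_eq_formAt_velocity (A : Connection B) {σ : ℝ → P} {a b : ℝ}
    (hab : a < b) (hσ : ContMDiffOn 𝓘(ℝ, ℝ) 𝓘(ℝ, EP) 1 σ (Icc a b)) :
    ∃ ξ : ℝ → EG, Continuous ξ ∧
      ∀ t ∈ Ioo a b, ξ t = A.formAt (σ t) (velocity EP σ t) := by
  -- The tangent map of `σ` on the unit vector field is continuous up to the end points. Composed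
  -- with the form, it is extended by constants to all of `ℝ`, so that the differential equation has
  -- a globally continuous right-hand side.
  have hT := hσ.continuousOn_tangentMapWithin le_rfl (uniqueDiffOn_Icc hab).uniqueMDiffOn
  have hs : Continuous (fun t : ℝ => (⟨t, (1 : ℝ)⟩ : TangentBundle 𝓘(ℝ, ℝ) ℝ)) :=
    (tangentBundleModelSpaceHomeomorph 𝓘(ℝ, ℝ)).symm.continuous.comp
      (continuous_id.prodMk (continuous_const (y := (1 : ℝ))))
  have h1 := A.contMDiff_form.continuous.comp_continuousOn
    (hT.comp hs.continuousOn (s := Icc a b) fun t ht => ht)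
  refine ⟨_, h1.domRestrict.Icc_extend' (h := hab.le), fun t ht => ?_⟩
  rw [IccExtend_of_mem _ _ (Ioo_subset_Icc_self ht)]
  change A.formAt (σ t) (mfderivWithin 𝓘(ℝ, ℝ) 𝓘(ℝ, EP) σ (Icc a b) t (1 : ℝ)) = _
  rw [mfderivWithin_of_mem_nhds (Icc_mem_nhds ht.1 ht.2)]
  rfl

variable [LieGroup 𝓘(ℝ, EG) ∞ G]

/-- A section over a `C¹` curve can be made horizontal near any time. -/
theorem Connection.exists_horizontal_act [CompleteSpace EG] (A : Connection B) {σ : ℝ → P}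
    {a b : ℝ} (hab : a < b) (hσ : ContMDiffOn 𝓘(ℝ, ℝ) 𝓘(ℝ, EP) 1 σ (Icc a b)) (t₀ : ℝ) :
    ∃ δ > 0, ∃ g : ℝ → G,
      ContMDiffOn 𝓘(ℝ, ℝ) 𝓘(ℝ, EP) 1 (fun t => B.act (σ t) (g t))
        (Icc a b ∩ Ioo (t₀ - δ) (t₀ + δ)) ∧
      ∀ t ∈ Ioo a b ∩ Ioo (t₀ - δ) (t₀ + δ),
        A.formAt (B.act (σ t) (g t)) (velocity EP (fun t => B.act (σ t) (g t)) t) = 0 := by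
  obtain ⟨ξ, hξ, hξσ⟩ := A.exists_continuous_eq_formAt_velocity hab hσ
  -- The equation `g' = dR_g (-ξ)`: the form sends the two terms of the velocity of `σ g` to
  -- `Ad(g⁻¹) ξ` and `Ad(g⁻¹) (-ξ)`.
  obtain ⟨δ, hδ, g, -, hg, hvel⟩ := exists_velocity_eq_tderiv_mul_right (G := G) hξ.neg t₀
  refine ⟨δ, hδ, g, ?_, fun t ht => ?_⟩
  · exact (B.contMDiff_act.of_le (by exact_mod_cast le_top)).comp_contMDiffOn
      ((hσ.mono inter_subset_left).prodMk (hg.mono inter_subset_right))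
  · have h1 : MDifferentiableAt 𝓘(ℝ, ℝ) 𝓘(ℝ, EP) σ t :=
      (hσ.contMDiffAt (Icc_mem_nhds ht.1.1 ht.1.2)).mdifferentiableAt (by simp)
    have h2 : MDifferentiableAt 𝓘(ℝ, ℝ) 𝓘(ℝ, EG) g t :=
      (hg.contMDiffAt (Ioo_mem_nhds ht.2.1 ht.2.2)).mdifferentiableAt (by simp)
    rw [B.velocity_act h1 h2, map_add, A.formAt_translate, hvel t ht.2,
      A.formAt_tderiv_mul_right, ← hξσ t ht.1, ← map_add]
    exact (congrArg _ (add_neg_cancel (ξ t))).trans (map_zero _)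

/-- Horizontal lifts of a `C¹` curve exist near any time. -/
theorem Connection.exists_isLift_near [CompleteSpace EG] (A : Connection B) {c : ℝ → M} {a b : ℝ}
    (hab : a < b) (hc : ContMDiffOn 𝓘(ℝ, ℝ) 𝓘(ℝ, EM) 1 c (Icc a b)) {t₀ : ℝ}
    (ht₀ : t₀ ∈ Icc a b) :
    ∃ ε > 0, ∀ u v, a ≤ u → u ≤ v → v ≤ b → t₀ - ε < u → v < t₀ + ε →
      ∀ p, B.proj p = c u → ∃ γ, γ u = p ∧ A.IsLift c γ u v := by
  obtain ⟨U, φ, hU, hxU, hsrc, htgt, hφs, -, hφ⟩ := B.locally_trivial (c t₀)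
  obtain ⟨η, hη, hηU⟩ : ∃ η > 0, ∀ t ∈ Icc a b, t₀ - η ≤ t → t ≤ t₀ + η → c t ∈ U := by
    have h1 := (hc.continuousOn t₀ ht₀).eventually_mem (hU.mem_nhds hxU)
    obtain ⟨η, hη, h2⟩ := (Metric.nhdsWithin_basis_ball.eventually_iff).1 h1
    rw [Real.ball_eq_Ioo] at h2
    exact ⟨η / 2, half_pos hη, fun t ht h3 h4 => h2 ⟨⟨by linarith, by linarith⟩, ht⟩⟩
  -- A nondegenerate closed interval in `[a, b]` on which `c` stays in the trivializing set; there
  -- `φ (c t, 1)` is a `C¹` section over `c`.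
  set a' := max a (t₀ - η)
  set b' := min b (t₀ + η)
  have hab' : a' < b' := max_lt (lt_min hab (by linarith [ht₀.1]))
    (lt_min (by linarith [ht₀.2]) (by linarith))
  have hcU : ∀ t ∈ Icc a' b', c t ∈ U := fun t ht =>
    hηU t ⟨(le_max_left _ _).trans ht.1, ht.2.trans (min_le_left _ _)⟩
      ((le_max_right _ _).trans ht.1) (ht.2.trans (min_le_right _ _))
  have hσ : ContMDiffOn 𝓘(ℝ, ℝ) 𝓘(ℝ, EP) 1 (fun t => φ (c t, 1)) (Icc a' b') :=
    (hφs.of_le (by exact_mod_cast le_top)).comp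
      ((hc.mono (Icc_subset_Icc (le_max_left _ _) (min_le_left _ _))).prodMk contMDiffOn_const)
      fun t ht => by rw [hsrc]; exact ⟨hcU t ht, mem_univ _⟩
  obtain ⟨δ, hδ, g, hg, hhor⟩ := A.exists_horizontal_act hab' hσ t₀
  refine ⟨min η δ, lt_min hη hδ, fun u v hu huv hv h1 h2 p hp => ?_⟩
  have hηδ := min_le_left η δ
  have hηδ' := min_le_right η δ
  have hu' : a' ≤ u := max_le hu (by linarith)
  have hv' : v ≤ b' := le_min hv (by linarith)
  have hl : A.IsLift c (fun t => B.act (φ (c t, 1)) (g t)) u v :=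
    { piecewiseC1 := .of_contMDiffOn (hg.mono fun t ht =>
        ⟨⟨hu'.trans ht.1, ht.2.trans hv'⟩, by linarith [ht.1], by linarith [ht.2]⟩)
      horizontal := ⟨∅, fun t ht _ => hhor t
        ⟨⟨hu'.trans_lt ht.1, ht.2.trans_le hv'⟩, by linarith [ht.1], by linarith [ht.2]⟩⟩
      proj_eq := fun t ht => (B.proj_act _ _).trans
        (hφ _ (hcU t ⟨hu'.trans ht.1, ht.2.trans hv'⟩) 1 1).1 }
  -- A single lift serves all starting points: translates of horizontal curves are horizontal, so
  -- `ε` does not depend on `p`.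
  obtain ⟨k, hk⟩ := B.exists_act_eq ((hl.proj_eq u ⟨le_rfl, huv⟩).trans hp.symm)
  exact ⟨_, hk, hl.translate k⟩

/-- Existence of horizontal lifts. -/
theorem Connection.exists_isLift [CompleteSpace EG] (A : Connection B) {c : ℝ → M} {a b : ℝ}
    (hab : a ≤ b) (hc : PiecewiseC1 EM c a b) {p : P} (hp : B.proj p = c a) :
    ∃ γ, γ a = p ∧ A.IsLift c γ a b := by
  -- One-point lifts cover the side of an end point of `[a, b]` where no nondegenerate interval is
  -- available.
  have hconst : ∀ (t : ℝ) (p : P), B.proj p = c t → ∃ γ, γ t = p ∧ A.IsLift c γ t t :=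
    fun t p hp => ⟨fun _ => p, rfl, .of_contMDiffOn contMDiffOn_const,
      ⟨∅, fun s hs _ => absurd (hs.1.trans hs.2) (lt_irrefl _)⟩, fun s hs => by
        rw [hp, le_antisymm hs.1 hs.2]⟩
  -- Quantifying over every starting point is what makes this relation transitive: the second lift
  -- starts where the first one happens to end.
  refine interval_induction
    (Q := fun u v => ∀ p, B.proj p = c u → ∃ γ, γ u = p ∧ A.IsLift c γ u v) hab
    (fun u v w _ huv hvw _ h h' p hp => ?_) (fun t ht => ?_) p hp
  · obtain ⟨γ, h1, h2⟩ := h p hp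
    obtain ⟨γ', h1', h2'⟩ := h' (γ v) (h2.proj_eq v ⟨huv, le_rfl⟩)
    exact ⟨switch v γ γ', (switch_of_le huv).trans h1, h2.switch h2' h1'.symm⟩
  · obtain ⟨ε, hε, hr, hl⟩ := hc.exists_contMDiffOn_nhds t
    have left : ∃ δ > 0, ∀ u ∈ Icc a b, u ≤ t → t - δ < u →
        ∀ p, B.proj p = c u → ∃ γ, γ u = p ∧ A.IsLift c γ u t := by
      rcases ht.1.eq_or_lt with h | h
      · refine ⟨1, one_pos, fun u hu hut _ => ?_⟩
        obtain rfl : u = t := le_antisymm hut (h ▸ hu.1)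
        exact hconst u
      · have h1 : max a (t - ε / 2) < t := max_lt h (by linarith)
        obtain ⟨δ, hδ, hQ⟩ := A.exists_isLift_near h1 (hl _ t (le_max_left _ _) ht.2
          (lt_of_lt_of_le (by linarith) (le_max_right _ _)) le_rfl) ⟨h1.le, le_rfl⟩
        refine ⟨min δ (ε / 2), lt_min hδ (by linarith), fun u hu hut hu' => ?_⟩
        have := min_le_left δ (ε / 2)
        have := min_le_right δ (ε / 2)
        exact hQ u t (max_le hu.1 (by linarith)) hut le_rfl (by linarith) (by linarith)
    have right : ∃ δ > 0, ∀ v ∈ Icc a b, t ≤ v → v < t + δ →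
        ∀ p, B.proj p = c t → ∃ γ, γ t = p ∧ A.IsLift c γ t v := by
      rcases ht.2.eq_or_lt with h | h
      · refine ⟨1, one_pos, fun v hv htv _ => ?_⟩
        obtain rfl : t = v := le_antisymm htv (h ▸ hv.2)
        exact hconst t
      · have h1 : t < min b (t + ε / 2) := lt_min h (by linarith)
        obtain ⟨δ, hδ, hQ⟩ := A.exists_isLift_near h1 (hr t _ ht.1 (min_le_left _ _) le_rfl
          (lt_of_le_of_lt (min_le_right _ _) (by linarith))) ⟨le_rfl, h1.le⟩
        refine ⟨min δ (ε / 2), lt_min hδ (by linarith), fun v hv htv hv' => ?_⟩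
        have := min_le_left δ (ε / 2)
        have := min_le_right δ (ε / 2)
        exact hQ t v le_rfl htv (le_min hv.2 (by linarith)) (by linarith) (by linarith)
    obtain ⟨δ, hδ, h1⟩ := left
    obtain ⟨δ', hδ', h2⟩ := right
    refine ⟨min δ δ', lt_min hδ hδ', fun u hu hut h => h1 u hu hut ?_,
      fun v hv htv h => h2 v hv htv ?_⟩
    · linarith [min_le_left δ δ']
    · linarith [min_le_right δ δ']

end Lift

/-! ### Uniqueness of horizontal lifts. -/

section Uniqueness

/-- At each time, including break points, the curve is `C¹` on a closed interval on either side, and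
the two one-sided continuities combine. -/
theorem PiecewiseC1.continuousOn {E X : Type*} [NormedAddCommGroup E] [NormedSpace ℝ E]
    [TopologicalSpace X] [ChartedSpace E X] {f : ℝ → X} {a b : ℝ} (hf : PiecewiseC1 E f a b) :
    ContinuousOn f (Icc a b) := by
  intro t ht
  obtain ⟨ε, hε, hr, hl⟩ := hf.exists_contMDiffOn_nhds t
  have h1 : ContinuousWithinAt f (Icc a t ∪ Icc t b) t := by
    refine ContinuousWithinAt.union ?_ ?_
    · have h := (hl (max a (t - ε / 2)) t (le_max_left _ _) ht.2
        (lt_of_lt_of_le (by linarith) (le_max_right _ _)) le_rfl).continuousOn t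
        ⟨max_le ht.1 (by linarith), le_rfl⟩
      refine h.mono_of_mem_nhdsWithin ?_
      filter_upwards [self_mem_nhdsWithin,
        mem_nhdsWithin_of_mem_nhds (Ioi_mem_nhds (by linarith : t - ε / 2 < t))] with s hs hs'
      exact ⟨max_le hs.1 (le_of_lt hs'), hs.2⟩
    · have h := (hr t (min b (t + ε / 2)) ht.1 (min_le_left _ _) le_rfl
        (lt_of_le_of_lt (min_le_right _ _) (by linarith))).continuousOn t
        ⟨le_rfl, le_min ht.2 (by linarith)⟩
      refine h.mono_of_mem_nhdsWithin ?_
      filter_upwards [self_mem_nhdsWithin,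
        mem_nhdsWithin_of_mem_nhds (Iio_mem_nhds (by linarith : t < t + ε / 2))] with s hs hs'
      exact ⟨hs.1, le_min hs.2 (le_of_lt hs')⟩
  rwa [Icc_union_Icc_eq_Icc ht.1 ht.2] at h1

/-- A continuous curve in the domain of a chart is constant if its velocity vanishes up to
finitely many times. -/
theorem eq_of_velocity_eq_zero {E X : Type*} [NormedAddCommGroup E] [NormedSpace ℝ E]
    [CompleteSpace E] [TopologicalSpace X] [ChartedSpace E X] [IsManifold 𝓘(ℝ, E) 1 X]
    {g : ℝ → X} {u v : ℝ} (huv : u ≤ v) (hg : ContinuousOn g (Icc u v)) (x₀ : X)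
    (hx₀ : ∀ t ∈ Icc u v, g t ∈ (extChartAt 𝓘(ℝ, E) x₀).source) (S : Finset ℝ)
    (hd : ∀ t ∈ Ioo u v, t ∉ S →
      MDifferentiableAt 𝓘(ℝ, ℝ) 𝓘(ℝ, E) g t ∧ velocity E g t = 0) : g u = g v := by
  refine (extChartAt 𝓘(ℝ, E) x₀).injOn (hx₀ u ⟨le_rfl, huv⟩) (hx₀ v ⟨huv, le_rfl⟩) ?_
  -- In chart coordinates the curve is continuous with derivative zero off a finite set, so the
  -- fundamental theorem of calculus makes its increment zero.
  have h1 := MeasureTheory.integral_eq_of_hasDerivAt_off_countable_of_le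
    (fun t => extChartAt 𝓘(ℝ, E) x₀ (g t)) (fun _ => (0 : E)) huv S.countable_toSet
    ((continuousOn_extChartAt x₀).comp hg hx₀) (fun t ht => ?_) (by simp)
  · rw [intervalIntegral.integral_zero] at h1
    exact (sub_eq_zero.1 h1.symm).symm
  · obtain ⟨h2, h3⟩ := hd t ht.1 (by simpa using ht.2)
    have h4 : MDifferentiableAt 𝓘(ℝ, E) 𝓘(ℝ, E) (extChartAt 𝓘(ℝ, E) x₀) (g t) :=
      (contMDiffAt_extChartAt' (n := 1) (by
        simpa [extChartAt_source] using hx₀ t (Ioo_subset_Icc_self ht.1))).mdifferentiableAt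
          (by simp)
    have h5 := velocity_comp h4 h2
    rw [h3, map_zero] at h5
    have h6 : DifferentiableAt ℝ (fun t => extChartAt 𝓘(ℝ, E) x₀ (g t)) t :=
      mdifferentiableAt_iff_differentiableAt.1 (h4.comp t h2)
    have h7 := h6.hasDerivAt
    rwa [← velocity_eq_deriv h7, h5] at h7

variable {EG EP EM G P M : Type*}
  [NormedAddCommGroup EG] [NormedSpace ℝ EG] [NormedAddCommGroup EP] [NormedSpace ℝ EP]
  [NormedAddCommGroup EM] [NormedSpace ℝ EM]
  [TopologicalSpace G] [ChartedSpace EG G] [Group G] [LieGroup 𝓘(ℝ, EG) ∞ G]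
  [TopologicalSpace P] [ChartedSpace EP P] [TopologicalSpace M] [ChartedSpace EM M]
  [IsManifold 𝓘(ℝ, EP) ∞ P] {B : PrincipalBundle EG EP EM G P M} {A : Connection B}

/-- If a curve and its product with a curve in the structure group are both horizontal at some
time, then the curve in the group has velocity zero. -/
theorem Connection.velocity_eq_zero_of_horizontal {γ : ℝ → P} {g : ℝ → G} {t : ℝ}
    (hγ : MDifferentiableAt 𝓘(ℝ, ℝ) 𝓘(ℝ, EP) γ t) (hg : MDifferentiableAt 𝓘(ℝ, ℝ) 𝓘(ℝ, EG) g t)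
    (h : A.formAt (γ t) (velocity EP γ t) = 0)
    (h' : A.formAt (B.act (γ t) (g t)) (velocity EP (fun t => B.act (γ t) (g t)) t) = 0) :
    velocity EG g t = 0 := by
  -- The velocity of `g` is `dL_g Y` with `Y = dL_{g⁻¹} g'`. The form sends the vertical part of the
  -- velocity of `γ g` to `Y` and its other part to zero, whence `Y = 0`.
  have h1 := tderiv_comp (E := EG) (E' := EG) (E'' := EG) (F := fun y : G => g t * y)
    (f := fun y : G => (g t)⁻¹ * y) (x := g t)
    (mdifferentiable_mul_left _ _) (mdifferentiable_mul_left _ _)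
  simp only [mul_inv_cancel_left, tderiv_id, inv_mul_cancel] at h1
  have h2 : velocity EG g t = tderiv EG EG (fun y : G => g t * y) 1
      (tderiv EG EG (fun y : G => (g t)⁻¹ * y) (g t) (velocity EG g t)) :=
    congrArg (fun L : EG →L[ℝ] EG => L (velocity EG g t)) h1
  rw [B.velocity_act hγ hg, map_add, A.formAt_translate, h, map_zero, zero_add, h2,
    A.formAt_tderiv_mul_left] at h'
  rw [h2, h', map_zero]

/-- Horizontal lifts of a curve that agree at some time agree at all near times. -/
theorem Connection.IsLift.eq_near [CompleteSpace EG] {c : ℝ → M} {γ γ' : ℝ → P} {a b : ℝ}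
    (h : A.IsLift c γ a b) (h' : A.IsLift c γ' a b) {t₀ : ℝ} (ht₀ : t₀ ∈ Icc a b) :
    ∃ ε > 0, ∀ u v, a ≤ u → u ≤ v → v ≤ b → t₀ - ε < u → v < t₀ + ε →
      γ u = γ' u → γ v = γ' v := by
  classical
  have hG : IsManifold 𝓘(ℝ, EG) ∞ G := LieGroup.toContMDiffMul.toIsManifold
  obtain ⟨U, φ, hU, hxU, hsrc, htgt, -, hφs, hφ⟩ := B.locally_trivial (B.proj (γ t₀))
  have hUo : IsOpen (B.proj ⁻¹' U) := hU.preimage B.contMDiff_proj.continuous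
  -- The quotient of the fiber coordinates of the two lifts: it satisfies `γ g = γ'` over `U`, and
  -- the smoothness of `φ.symm` passes the regularity of the lifts on to it.
  set g : ℝ → G := fun t => (φ.symm (γ t)).2⁻¹ * (φ.symm (γ' t)).2 with hgdef
  have hφsAt : ∀ p, B.proj p ∈ U →
      ContMDiffAt 𝓘(ℝ, EP) 𝓘(ℝ, EG) ∞ (fun p => (φ.symm p).2) p := fun p hp =>
    contMDiffAt_snd.comp p (hφs.contMDiffAt (by rw [htgt]; exact hUo.mem_nhds hp))
  have hact : ∀ t ∈ Icc a b, B.proj (γ t) ∈ U → B.act (γ t) (g t) = γ' t := fun t ht hU => by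
    have h1 : γ t ∈ φ.target := by rw [htgt]; exact hU
    have hpp : B.proj (γ t) = B.proj (γ' t) := (h.proj_eq t ht).trans (h'.proj_eq t ht).symm
    have h2 : γ' t ∈ φ.target := by rw [htgt]; exact (by rwa [← hpp] : B.proj (γ' t) ∈ U)
    have key : ∀ p ∈ φ.target, φ (B.proj p, (φ.symm p).2) = p := fun p hp => by
      have h3 := φ.map_target hp
      rw [hsrc] at h3
      have h4 := (hφ _ h3.1 (φ.symm p).2 1).1
      rw [φ.right_inv hp] at h4
      rw [h4]
      exact φ.right_inv hp
    have h5 := (hφ (B.proj (γ t)) hU (φ.symm (γ t)).2 (g t)).2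
    rw [key _ h1, hgdef, mul_inv_cancel_left] at h5
    rw [h5, hpp, key _ h2]
  have hgc : ∀ t ∈ Icc a b, B.proj (γ t) ∈ U → ContinuousWithinAt g (Icc a b) t :=
    fun t ht htU => by
    have htU' : B.proj (γ' t) ∈ U := by rwa [h'.proj_eq t ht, ← h.proj_eq t ht]
    have h1 : ContinuousWithinAt (fun t => (φ.symm (γ t)).2) (Icc a b) t :=
      ContinuousAt.comp_continuousWithinAt (g := fun p => (φ.symm p).2) (hφsAt _ htU).continuousAt
        (h.piecewiseC1.continuousOn t ht)
    have h2 : ContinuousWithinAt (fun t => (φ.symm (γ' t)).2) (Icc a b) t :=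
      ContinuousAt.comp_continuousWithinAt (g := fun p => (φ.symm p).2) (hφsAt _ htU').continuousAt
        (h'.piecewiseC1.continuousOn t ht)
    have hTG : IsTopologicalGroup G := topologicalGroup_of_lieGroup 𝓘(ℝ, EG) ∞
    exact h1.inv.mul h2
  have h1 : ∀ᶠ t in 𝓝[Icc a b] t₀, B.proj (γ t) ∈ U :=
    (h.piecewiseC1.continuousOn t₀ ht₀).eventually_mem (hUo.mem_nhds hxU)
  -- Near `t₀` the curve `g` stays in one chart, as `eq_of_velocity_eq_zero` requires.
  have h2 : ∀ᶠ t in 𝓝[Icc a b] t₀, g t ∈ (extChartAt 𝓘(ℝ, EG) (g t₀)).source :=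
    (hgc t₀ ht₀ hxU).eventually_mem (extChartAt_source_mem_nhds (g t₀))
  obtain ⟨ε, hε, hball⟩ := (Metric.nhdsWithin_basis_ball.eventually_iff).1 (h1.and h2)
  rw [Real.ball_eq_Ioo] at hball
  obtain ⟨S₁, hS₁⟩ := h.piecewiseC1.exists_mdifferentiableAt
  obtain ⟨S₂, hS₂⟩ := h'.piecewiseC1.exists_mdifferentiableAt
  obtain ⟨S₃, hS₃⟩ := h.horizontal
  obtain ⟨S₄, hS₄⟩ := h'.horizontal
  refine ⟨ε, hε, fun u v hau huv hvb hu hv hγu => ?_⟩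
  have hsub : ∀ t ∈ Icc u v, t ∈ Icc a b ∧ B.proj (γ t) ∈ U ∧
      g t ∈ (extChartAt 𝓘(ℝ, EG) (g t₀)).source := fun t ht =>
    have h3 : t ∈ Icc a b := ⟨hau.trans ht.1, ht.2.trans hvb⟩
    ⟨h3, hball ⟨⟨by linarith [ht.1], by linarith [ht.2]⟩, h3⟩⟩
  have huU := hsub u ⟨le_rfl, huv⟩
  have hvU := hsub v ⟨huv, le_rfl⟩
  have hguv : g u = g v := by
    refine eq_of_velocity_eq_zero huv (fun t ht => ?_) (g t₀) (fun t ht => (hsub t ht).2.2)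
      (S₁ ∪ S₂ ∪ S₃ ∪ S₄) fun t ht hts => ?_
    · exact (hgc t (hsub t ht).1 (hsub t ht).2.1).mono (Icc_subset_Icc hau hvb)
    · simp only [Finset.mem_union, not_or] at hts
      obtain ⟨⟨⟨h3, h4⟩, h5⟩, h6⟩ := hts
      have htab : t ∈ Ioo a b := ⟨hau.trans_lt ht.1, ht.2.trans_le hvb⟩
      have htU := (hsub t (Ioo_subset_Icc_self ht)).2.1
      have htU' : B.proj (γ' t) ∈ U := by
        rwa [h'.proj_eq t (Ioo_subset_Icc_self htab), ← h.proj_eq t (Ioo_subset_Icc_self htab)]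
      have hgd : MDifferentiableAt 𝓘(ℝ, ℝ) 𝓘(ℝ, EG) g t := by
        have h7 : MDifferentiableAt 𝓘(ℝ, ℝ) 𝓘(ℝ, EG) (fun t => (φ.symm (γ t)).2) t :=
          ((hφsAt _ htU).mdifferentiableAt (by simp)).comp t (hS₁ t htab h3)
        have h8 : MDifferentiableAt 𝓘(ℝ, ℝ) 𝓘(ℝ, EG) (fun t => (φ.symm (γ' t)).2) t :=
          ((hφsAt _ htU').mdifferentiableAt (by simp)).comp t (hS₂ t htab h4)
        have h9 : MDifferentiableAt (𝓘(ℝ, EG).prod 𝓘(ℝ, EG)) 𝓘(ℝ, EG)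
            (fun x : G × G => x.1⁻¹ * x.2) ((φ.symm (γ t)).2, (φ.symm (γ' t)).2) :=
          (ContMDiff.mul (n := ∞) (I := 𝓘(ℝ, EG)) (ContMDiff.inv contMDiff_fst)
            contMDiff_snd).mdifferentiable (by simp) _
        exact h9.comp t (h7.prodMk h8)
      have hev : (fun t => B.act (γ t) (g t)) =ᶠ[𝓝 t] γ' := by
        filter_upwards [Ioo_mem_nhds ht.1 ht.2] with s hs
        have h10 := hsub s (Ioo_subset_Icc_self hs)
        exact hact s h10.1 h10.2.1
      exact ⟨hgd, A.velocity_eq_zero_of_horizontal (hS₁ t htab h3) hgd (hS₃ t htab h5)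
        (A.formAt_velocity_congr hev (hS₄ t htab h6))⟩
  have hgu : g u = 1 := B.act_free (γ u) _ ((hact u huU.1 huU.2.1).trans hγu.symm)
  have h11 := hact v hvU.1 hvU.2.1
  rw [← hguv, hgu, B.act_one] at h11
  exact h11

theorem Connection.IsLift.mono {c : ℝ → M} {γ : ℝ → P} {a b a' b' : ℝ} (h : A.IsLift c γ a b)
    (ha : a ≤ a') (hb : b' ≤ b) : A.IsLift c γ a' b' where
  piecewiseC1 := h.piecewiseC1.mono ha hb
  horizontal := h.horizontal.imp fun _ hS t ht => hS t ⟨ha.trans_lt ht.1, ht.2.trans_le hb⟩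
  proj_eq t ht := h.proj_eq t ⟨ha.trans ht.1, ht.2.trans hb⟩

/-- Uniqueness of horizontal lifts. -/
theorem Connection.IsLift.eqOn [CompleteSpace EG] {c : ℝ → M} {γ γ' : ℝ → P} {a b : ℝ}
    (h : A.IsLift c γ a b) (h' : A.IsLift c γ' a b) (ha : γ a = γ' a) :
    EqOn γ γ' (Icc a b) := by
  intro s hs
  -- The induction propagates the implication from agreement at `u` to agreement at `v`, which is
  -- transitive with no assumption that the lifts agree anywhere.
  refine interval_induction (Q := fun u v => γ u = γ' u → γ v = γ' v) hs.1
    (fun u v w _ _ _ _ h1 h2 h3 => h2 (h1 h3)) (fun t ht => ?_) ha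
  obtain ⟨ε, hε, hQ⟩ := (h.mono le_rfl hs.2).eq_near (h'.mono le_rfl hs.2) ht
  exact ⟨ε, hε, fun u hu hut hu' => hQ u t hu.1 hut ht.2 hu' (by linarith),
    fun v hv htv hv' => hQ t v ht.1 htv hv.2 (by linarith) hv'⟩

end Uniqueness

/-! ### Reparametrization, reversal and concatenation of lifts. -/

section Reparametrization

/-- The break points are those of `φ` and the preimages of those of `f`; injectivity of `φ` keeps
them finite in number. -/
theorem PiecewiseC1.comp_strictMonoOn {E X : Type*} [NormedAddCommGroup E] [NormedSpace ℝ E]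
    [TopologicalSpace X] [ChartedSpace E X] {f : ℝ → X} {a b a' b' : ℝ} {φ : ℝ → ℝ}
    (hf : PiecewiseC1 E f a b) (hφ : PiecewiseC1 ℝ φ a' b') (hm : StrictMonoOn φ (Icc a' b'))
    (ha : φ a' = a) (hb : φ b' = b) : PiecewiseC1 E (fun t => f (φ t)) a' b' := by
  classical
  have hcont := hφ.continuousOn
  obtain ⟨S, hS⟩ := hf
  obtain ⟨S', hS'⟩ := hφ
  have hfin : (Icc a' b' ∩ φ ⁻¹' (S : Set ℝ)).Finite :=
    Finite.of_finite_image (S.finite_toSet.subset (by rintro _ ⟨t, ht, rfl⟩; exact ht.2))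
      (hm.injOn.mono inter_subset_left)
  refine ⟨S' ∪ hfin.toFinset, fun u v hu hv hs => ?_⟩
  rcases lt_or_ge v u with huv | huv
  · rw [Icc_eq_empty (not_le.2 huv)]
    exact fun t ht => ht.elim
  have hu' : u ∈ Icc a' b' := ⟨hu, huv.trans hv⟩
  have hv' : v ∈ Icc a' b' := ⟨hu.trans huv, hv⟩
  have hab : a' ≤ b' := hu.trans (huv.trans hv)
  have hsub : Icc u v ⊆ Icc a' b' := Icc_subset_Icc hu hv
  refine (hS (φ u) (φ v) ?_ ?_ fun s hsS hsuv => ?_).comp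
    (hS' u v hu hv fun s hs' => hs s (by simp [hs'])) fun t ht =>
      ⟨hm.monotoneOn hu' (hsub ht) ht.1, hm.monotoneOn (hsub ht) hv' ht.2⟩
  · rw [← ha]
    exact hm.monotoneOn ⟨le_rfl, hab⟩ hu' hu
  · rw [← hb]
    exact hm.monotoneOn hv' ⟨hab, le_rfl⟩ hv
  -- By the intermediate value theorem, a break point of `f` between `φ u` and `φ v` would come from
  -- an excluded time between `u` and `v`.
  · obtain ⟨r, hr, rfl⟩ := intermediate_value_Ioo huv (hcont.mono hsub) hsuv
    exact hs r (by simpa using Or.inr ⟨hsub (Ioo_subset_Icc_self hr), hsS⟩) hr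

variable {EG EP EM G P M : Type*}
  [NormedAddCommGroup EG] [NormedSpace ℝ EG] [NormedAddCommGroup EP] [NormedSpace ℝ EP]
  [NormedAddCommGroup EM] [NormedSpace ℝ EM]
  [TopologicalSpace G] [ChartedSpace EG G] [Group G] [LieGroup 𝓘(ℝ, EG) ∞ G]
  [TopologicalSpace P] [ChartedSpace EP P] [TopologicalSpace M] [ChartedSpace EM M]
  [IsManifold 𝓘(ℝ, EP) ∞ P] {B : PrincipalBundle EG EP EM G P M} {A : Connection B}

/-- By the chain rule the new velocity is a multiple of the old one. Only injectivity of `φ` is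
asked, not monotonicity, so that time reversal is covered too. -/
theorem Connection.IsHorizontalOn.comp {γ : ℝ → P} {φ : ℝ → ℝ} {a b a' b' : ℝ}
    (h : A.IsHorizontalOn γ a b) (hγ : PiecewiseC1 EP γ a b) (hφ : PiecewiseC1 ℝ φ a' b')
    (hinj : InjOn φ (Ioo a' b')) (hmaps : MapsTo φ (Ioo a' b') (Ioo a b)) :
    A.IsHorizontalOn (fun t => γ (φ t)) a' b' := by
  classical
  obtain ⟨S₁, hS₁⟩ := h
  obtain ⟨S₂, hS₂⟩ := hγ.exists_mdifferentiableAt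
  obtain ⟨S₃, hS₃⟩ := hφ.exists_mdifferentiableAt
  have hfin : (Ioo a' b' ∩ φ ⁻¹' (↑(S₁ ∪ S₂) : Set ℝ)).Finite :=
    Finite.of_finite_image ((S₁ ∪ S₂).finite_toSet.subset
      (by rintro _ ⟨t, ht, rfl⟩; exact ht.2)) (hinj.mono inter_subset_left)
  refine ⟨S₃ ∪ hfin.toFinset, fun t ht hts => ?_⟩
  simp only [Finset.mem_union, not_or, Finite.mem_toFinset, mem_inter_iff, mem_preimage,
    Finset.coe_union, mem_union, Finset.mem_coe, not_and] at hts
  obtain ⟨h3, h4⟩ := hts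
  obtain ⟨h1, h2⟩ := h4 ht
  have hd := hS₂ _ (hmaps ht) h2
  have hlin : ∀ r : ℝ, A.formAt (γ (φ t)) (tderiv ℝ EP γ (φ t) r) = 0 := fun r => by
    have h5 : tderiv ℝ EP γ (φ t) r = r • velocity EP γ (φ t) := by
      rw [velocity, ← map_smul, smul_eq_mul, mul_one]
    rw [h5, map_smul, hS₁ _ (hmaps ht) h1, smul_zero]
  rw [velocity_comp (F := γ) hd (hS₃ t ht h3)]
  exact hlin _

theorem Connection.IsLift.comp_strictMonoOn {c : ℝ → M} {γ : ℝ → P} {φ : ℝ → ℝ} {a b a' b' : ℝ}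
    (h : A.IsLift c γ a b) (hφ : PiecewiseC1 ℝ φ a' b') (hm : StrictMonoOn φ (Icc a' b'))
    (hab : a' ≤ b') (ha : φ a' = a) (hb : φ b' = b) :
    A.IsLift (fun t => c (φ t)) (fun t => γ (φ t)) a' b' where
  piecewiseC1 := h.piecewiseC1.comp_strictMonoOn hφ hm ha hb
  horizontal := by
    refine h.horizontal.comp h.piecewiseC1 hφ (hm.injOn.mono Ioo_subset_Icc_self) fun t ht => ?_
    rw [← ha, ← hb]
    exact ⟨hm ⟨le_rfl, hab⟩ (Ioo_subset_Icc_self ht) ht.1,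
      hm (Ioo_subset_Icc_self ht) ⟨hab, le_rfl⟩ ht.2⟩
  proj_eq t ht := by
    refine h.proj_eq (φ t) ?_
    rw [← ha, ← hb]
    exact ⟨hm.monotoneOn ⟨le_rfl, hab⟩ ht ht.1, hm.monotoneOn ht ⟨hab, le_rfl⟩ ht.2⟩

theorem Connection.IsLift.reverse {c : ℝ → M} {γ : ℝ → P} {l : ℝ} (h : A.IsLift c γ 0 l) :
    A.IsLift (fun t => c (l - t)) (fun t => γ (l - t)) 0 l where
  piecewiseC1 := h.piecewiseC1.reverse
  horizontal := h.horizontal.comp h.piecewiseC1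
    (.of_contMDiff (contDiff_const.sub contDiff_id).contMDiff _ _)
    (fun _ _ _ _ h => sub_right_injective h) fun t ht => ⟨by linarith [ht.2], by linarith [ht.1]⟩
  proj_eq t ht := h.proj_eq (l - t) ⟨by linarith [ht.2], by linarith [ht.1]⟩

/-- Shifting the second lift to `[l, l + l']` turns `glue` into `switch`. -/
theorem Connection.IsLift.glue {c c' : ℝ → M} {γ γ' : ℝ → P} {l l' : ℝ} (hl : 0 ≤ l)
    (hl' : 0 ≤ l') (h : A.IsLift c γ 0 l) (h' : A.IsLift c' γ' 0 l') (he : γ l = γ' 0) :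
    A.IsLift (glue l c c') (glue l γ γ') 0 (l + l') := by
  have h1 : A.IsLift (fun t => c' (t - l)) (fun t => γ' (t - l)) l (l + l') :=
    h'.comp_strictMonoOn (.of_contMDiff (contDiff_id.sub contDiff_const).contMDiff _ _)
      (fun _ _ _ _ h => sub_lt_sub_right h l) (by linarith) (by simp) (by simp)
  have hc : c l = c' 0 := by
    rw [← h.proj_eq l ⟨hl, le_rfl⟩, he, h'.proj_eq 0 ⟨le_rfl, hl'⟩]
  refine IsLift.switch (h.congr (fun t ht => if_pos ht.2) fun t _ => rfl)
    (h1.congr (fun t ht => ?_) fun t _ => rfl) (by simp [he])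
  rcases ht.1.eq_or_lt with rfl | h2
  · simp [CatBundle.glue, hc]
  · simp [CatBundle.glue, not_le.2 h2]

end Reparametrization

/-! ### Lifting backtrack equivalences. -/

section PathLift

variable {EG EP EM G P M : Type*}
  [NormedAddCommGroup EG] [NormedSpace ℝ EG] [NormedAddCommGroup EP] [NormedSpace ℝ EP]
  [NormedAddCommGroup EM] [NormedSpace ℝ EM]
  [TopologicalSpace G] [ChartedSpace EG G] [Group G] [LieGroup 𝓘(ℝ, EG) ∞ G]
  [TopologicalSpace P] [ChartedSpace EP P] [TopologicalSpace M] [ChartedSpace EM M]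
  [IsManifold 𝓘(ℝ, EP) ∞ P] {B : PrincipalBundle EG EP EM G P M}

/-- The path `γ` on `P` is a horizontal lift of the path `c`. -/
structure Connection.IsPathLift (A : Connection B) {x y : M} {p q : P} (c : PwPath EM x y)
    (γ : PwPath EP p q) : Prop where
  len_eq : γ.len = c.len
  isLift : A.IsLift c.toFun γ.toFun 0 c.len

variable {A : Connection B} {x y z : M} {p q r : P}

theorem Connection.IsPathLift.trans {c : PwPath EM x y} {d : PwPath EM y z} {γ : PwPath EP p q}
    {δ : PwPath EP q r} (h : A.IsPathLift c γ) (h' : A.IsPathLift d δ) :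
    A.IsPathLift (c.trans d) (γ.trans δ) where
  len_eq := congrArg₂ (· + ·) h.len_eq h'.len_eq
  isLift := by
    have h1 := h.isLift.glue c.len_nonneg d.len_nonneg h'.isLift
      (by rw [← h.len_eq, γ.target, δ.source])
    have h2 : (γ.trans δ).toFun = CatBundle.glue c.len γ.toFun δ.toFun := by
      rw [← h.len_eq]
      rfl
    rw [h2]
    exact h1

theorem Connection.IsPathLift.symm {c : PwPath EM x y} {γ : PwPath EP p q}
    (h : A.IsPathLift c γ) : A.IsPathLift c.symm γ.symm where
  len_eq := h.len_eq
  isLift := by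
    have h2 : γ.symm.toFun = fun t => γ.toFun (c.len - t) := by
      rw [← h.len_eq]
      rfl
    rw [h2]
    exact h.isLift.reverse

theorem Connection.isPathLift_map (hB : ContMDiff 𝓘(ℝ, EP) 𝓘(ℝ, EM) 1 B.proj)
    {γ : PwPath EP p q} (h : A.IsHorizontalPath γ) : A.IsPathLift (γ.map hB) γ :=
  ⟨rfl, γ.piecewiseC1, h, fun _ _ => rfl⟩

theorem Connection.IsPathLift.isHorizontalPath {c : PwPath EM x y} {γ : PwPath EP p q}
    (h : A.IsPathLift c γ) : A.IsHorizontalPath γ := by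
  have h1 := h.isLift.horizontal
  rwa [← h.len_eq] at h1

theorem Connection.IsPathLift.proj_target {c : PwPath EM x y} {γ : PwPath EP p q}
    (h : A.IsPathLift c γ) : B.proj q = y := by
  rw [← γ.target, h.len_eq, h.isLift.proj_eq _ ⟨c.len_nonneg, le_rfl⟩, c.target]

variable [CompleteSpace EG]

theorem Connection.exists_isPathLift (A : Connection B) (c : PwPath EM x y) (hp : B.proj p = x) :
    ∃ (q : P) (γ : PwPath EP p q), A.IsPathLift c γ := by
  obtain ⟨γ, h0, h⟩ := A.exists_isLift c.len_nonneg c.piecewiseC1 (hp.trans c.source.symm)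
  exact ⟨γ c.len, ⟨c.len, γ, c.len_nonneg, h0, rfl, h.piecewiseC1⟩, rfl, h⟩

/-- The lift of a reparametrized path is the reparametrized lift. -/
theorem Connection.IsPathLift.exists_reparam {c c' : PwPath EM x y} {γ : PwPath EP p q}
    {γ' : PwPath EP p r} (h : A.IsPathLift c γ) (h' : A.IsPathLift c' γ')
    (hr : PwPath.IsReparam c' c) :
    ∃ φ : ℝ → ℝ, StrictMonoOn φ (Icc 0 γ'.len) ∧ PiecewiseC1 ℝ φ 0 γ'.len ∧
      φ 0 = 0 ∧ φ γ'.len = γ.len ∧ ∀ t ∈ Icc 0 γ'.len, γ'.toFun t = γ.toFun (φ t) := by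
  obtain ⟨φ, hm, hφ, h0, h1, he⟩ := hr
  rw [h'.len_eq]
  refine ⟨φ, hm, hφ, h0, h1.trans h.len_eq.symm, ?_⟩
  have hl := (h.isLift.comp_strictMonoOn hφ hm c'.len_nonneg h0 h1).congr
    (c' := c'.toFun) he (fun t _ => rfl)
  exact h'.isLift.eqOn hl (by rw [γ'.source, h0, γ.source])

theorem Connection.IsPathLift.target_eq {c c' : PwPath EM x y} {γ : PwPath EP p q}
    {γ' : PwPath EP p r} (h : A.IsPathLift c γ) (h' : A.IsPathLift c' γ')
    (hr : PwPath.IsReparam c' c) : r = q := by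
  obtain ⟨φ, -, -, -, h1, he⟩ := h.exists_reparam h' hr
  have := he _ ⟨γ'.len_nonneg, le_rfl⟩
  rwa [h1, γ.target, γ'.target] at this

/-- Backtrack equivalences lift: elementary case. -/
theorem Connection.IsPathLift.exists_of_elemBacktrack {c c' : PwPath EM x y} {γ : PwPath EP p q}
    (h : A.IsPathLift c γ) (hc : PwPath.ElemBacktrack c c') :
    ∃ γ' : PwPath EP p q, A.IsPathLift c' γ' ∧ PwPath.ElemBacktrack γ γ' := by
  have hp : B.proj p = x := by
    rw [← γ.source, h.isLift.proj_eq 0 ⟨le_rfl, c.len_nonneg⟩, c.source]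
  obtain ⟨u, v, a, d, b, hc⟩ := hc
  obtain ⟨u', a', ha⟩ := A.exists_isPathLift a hp
  obtain ⟨v', d', hd⟩ := A.exists_isPathLift d ha.proj_target
  obtain ⟨q', b', hb⟩ := A.exists_isPathLift b ha.proj_target
  -- The reversed lift of `d` leads back to the end `u'` of the lift of `a`, so the same lift `b'`
  -- completes both the long and the short path.
  have long := ha.trans (hd.trans (hd.symm.trans hb))
  have short := ha.trans hb
  obtain ⟨r, δ, hδ⟩ := A.exists_isPathLift c' hp
  rcases hc with ⟨h1, h2⟩ | ⟨h1, h2⟩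
  -- Uniqueness identifies `q` with the end of `b'`, and then the end of the lift of `c'` with `q`.
  · obtain rfl := h.target_eq long h1
    obtain rfl := hδ.target_eq short h2
    exact ⟨δ, hδ, u', v', a', d', b', .inl ⟨h.exists_reparam long h1, hδ.exists_reparam short h2⟩⟩
  · obtain rfl := h.target_eq short h2
    obtain rfl := hδ.target_eq long h1
    exact ⟨δ, hδ, u', v', a', d', b', .inr ⟨hδ.exists_reparam long h1, h.exists_reparam short h2⟩⟩

theorem PwPath.ElemBacktrack.swap {c c' : PwPath EM x y} (h : PwPath.ElemBacktrack c c') :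
    PwPath.ElemBacktrack c' c := by
  obtain ⟨u, v, a, d, b, h⟩ := h
  exact ⟨u, v, a, d, b, h.symm⟩

/-- Backtrack equivalences lift. -/
theorem Connection.exists_isPathLift_of_eqvGen (A : Connection B) {c c' : PwPath EM x y}
    (hc : Relation.EqvGen PwPath.ElemBacktrack c c') :
    (∀ {p q : P} {γ : PwPath EP p q}, A.IsPathLift c γ →
      ∃ γ' : PwPath EP p q, A.IsPathLift c' γ' ∧ BtPath.mk γ = BtPath.mk γ') ∧
    ∀ {p q : P} {γ : PwPath EP p q}, A.IsPathLift c' γ →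
      ∃ γ' : PwPath EP p q, A.IsPathLift c γ' ∧ BtPath.mk γ = BtPath.mk γ' := by
  -- Both directions are carried along so that the symmetric case is an exchange.
  induction hc with
  | rel c c' h =>
    refine ⟨fun hγ => ?_, fun hγ => ?_⟩
    · obtain ⟨γ', h1, h2⟩ := hγ.exists_of_elemBacktrack h
      exact ⟨γ', h1, Quotient.sound (.rel _ _ h2)⟩
    · obtain ⟨γ', h1, h2⟩ := hγ.exists_of_elemBacktrack h.swap
      exact ⟨γ', h1, Quotient.sound (.rel _ _ h2)⟩
  | refl c => exact ⟨fun hγ => ⟨_, hγ, rfl⟩, fun hγ => ⟨_, hγ, rfl⟩⟩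
  | symm c c' _ ih => exact ⟨ih.2, ih.1⟩
  | trans c c' c'' _ _ ih ih' =>
    refine ⟨fun hγ => ?_, fun hγ => ?_⟩
    · obtain ⟨δ, h1, h2⟩ := ih.1 hγ
      obtain ⟨ε, h3, h4⟩ := ih'.1 h1
      exact ⟨ε, h3, h2.trans h4⟩
    · obtain ⟨δ, h1, h2⟩ := ih'.2 hγ
      obtain ⟨ε, h3, h4⟩ := ih.2 h1
      exact ⟨ε, h3, h2.trans h4⟩

/-- A backtrack-erased path, as an element of the set of all morphisms. -/
def BtPath.arrow {E X : Type*} [NormedAddCommGroup E] [NormedSpace ℝ E] [TopologicalSpace X]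
    [ChartedSpace E X] {x y : X} (f : BtPath E x y) : Arrow (PathCat E X) :=
  Arrow.mk (X := (x : PathCat E X)) (Y := (y : PathCat E X)) f

/-- The lift of a backtrack-erased path from a given point is unique. -/
theorem Connection.IsPathLift.arrow_eq {y' : M} {c : PwPath EM x y} {c' : PwPath EM x y'}
    {γ : PwPath EP p q} {γ' : PwPath EP p r} (h : A.IsPathLift c γ) (h' : A.IsPathLift c' γ')
    (hc : (BtPath.mk c).arrow = (BtPath.mk c').arrow) :
    (BtPath.mk γ).arrow = (BtPath.mk γ').arrow := by
  obtain rfl : y = y' := congrArg (fun F : Arrow (PathCat EM M) => F.right) hc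
  obtain ⟨δ, h1, h2⟩ := (A.exists_isPathLift_of_eqvGen
    (Quotient.exact (Arrow.mk_injective _ _ hc))).1 h
  obtain rfl := h'.target_eq h1 (PwPath.isReparam_self c')
  have h3 : PwPath.IsReparam δ γ' := h'.exists_reparam h1 (PwPath.isReparam_self c')
  rw [h2]
  exact congrArg BtPath.arrow (Quotient.sound (.rel _ _ (.of_isReparam h3)))

end PathLift

/-! ### Comparison of morphisms with different end points. -/

section ArrowLemmas

variable {C : Type*} [Category C]

/-- In `Arrow C` the end points belong to the data, so `eqToHom` adjustments disappear. Equations of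
morphisms are proved there and brought back by `Arrow.mk_injective`. -/
theorem arrow_comp_eqToHom {a b c : C} (f : a ⟶ b) (h : b = c) :
    Arrow.mk (f ≫ eqToHom h) = Arrow.mk f := by
  subst h
  simp

theorem arrow_eqToHom_comp {a b c : C} (h : a = b) (f : b ⟶ c) :
    Arrow.mk (eqToHom h ≫ f) = Arrow.mk f := by
  subst h
  simp

theorem arrow_comp_congr {a b c a' b' c' : C} {f : a ⟶ b} {g : b ⟶ c} {f' : a' ⟶ b'}
    {g' : b' ⟶ c'} (hf : Arrow.mk f = Arrow.mk f') (hg : Arrow.mk g = Arrow.mk g') :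
    Arrow.mk (f ≫ g) = Arrow.mk (f' ≫ g') := by
  obtain rfl : a = a' := congrArg (fun F : Arrow C => F.left) hf
  obtain rfl : b = b' := congrArg (fun F : Arrow C => F.right) hf
  obtain rfl : c = c' := congrArg (fun F : Arrow C => F.right) hg
  rw [Arrow.mk_injective _ _ hf, Arrow.mk_injective _ _ hg]

theorem arrow_map_congr {D : Type*} [Category D] (F : C ⥤ D) {a b a' b' : C} {f : a ⟶ b}
    {f' : a' ⟶ b'} (h : Arrow.mk f = Arrow.mk f') : Arrow.mk (F.map f) = Arrow.mk (F.map f') :=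
  congrArg F.mapArrow.obj h

end ArrowLemmas

/-! ### Right translations of backtrack-erased paths. -/

section Translation

variable {EG EP EM G P M : Type*}
  [NormedAddCommGroup EG] [NormedSpace ℝ EG] [NormedAddCommGroup EP] [NormedSpace ℝ EP]
  [NormedAddCommGroup EM] [NormedSpace ℝ EM]
  [TopologicalSpace G] [ChartedSpace EG G] [Group G]
  [TopologicalSpace P] [ChartedSpace EP P] [TopologicalSpace M] [ChartedSpace EM M]
  [IsManifold 𝓘(ℝ, EP) ∞ P] {B : PrincipalBundle EG EP EM G P M}

theorem arrow_translate_congr {p q p' q' : PathCat EP P} {f : p ⟶ q} {f' : p' ⟶ q'} {g g' : G}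
    (h : Arrow.mk f = Arrow.mk f') (hg : g = g') :
    Arrow.mk ((B.translate g).map f) = Arrow.mk ((B.translate g').map f') := by
  subst hg
  exact arrow_map_congr _ h

theorem arrow_translate_one {p q : PathCat EP P} (f : p ⟶ q) :
    Arrow.mk ((B.translate 1).map f) = Arrow.mk f := by
  rw [translate_map_one, arrow_eqToHom_comp, arrow_comp_eqToHom]

theorem arrow_translate_mul {p q : PathCat EP P} (f : p ⟶ q) (g h : G) :
    Arrow.mk ((B.translate h).map ((B.translate g).map f)) =
      Arrow.mk ((B.translate (g * h)).map f) := by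
  rw [translate_map_mul, arrow_eqToHom_comp, arrow_comp_eqToHom]

/-- Translation followed by projection is the projection, as maps. In `key` both maps are variables,
so that their equality can be substituted. -/
theorem arrow_projPath_translate {p q : PathCat EP P} (f : p ⟶ q) (g : G) :
    Arrow.mk (B.projPath.map ((B.translate g).map f)) = Arrow.mk (B.projPath.map f) := by
  have key : ∀ (F F' : P → M) (hF : ContMDiff 𝓘(ℝ, EP) 𝓘(ℝ, EM) 1 F)
      (hF' : ContMDiff 𝓘(ℝ, EP) 𝓘(ℝ, EM) 1 F') (_ : F = F'),
      Arrow.mk ((PathCat.map hF).map f) = Arrow.mk ((PathCat.map hF').map f) := by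
    rintro F F' hF hF' rfl
    rfl
  refine Eq.trans ?_ (key (fun p => B.proj (B.act p g)) B.proj
    ((B.contMDiff_proj.comp (B.contMDiff_translate g)).of_le (by exact_mod_cast le_top))
    (B.contMDiff_proj.of_le (by exact_mod_cast le_top)) (funext fun p => B.proj_act p g))
  induction f using Quotient.inductionOn with
  | h f => rfl

theorem PrincipalBundle.act_left_injective (B : PrincipalBundle EG EP EM G P M) (g : G) :
    Function.Injective fun p => B.act p g := fun p q h => by
  have h1 := congrArg (fun p => B.act p g⁻¹) h
  simpa only [B.act_inv_act] using h1

end Translation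

/-! ### The functors on decorated paths and the principal bundle axioms. -/

section Decorated

variable {EG EH EP EM G H P M : Type*}
  [NormedAddCommGroup EG] [NormedSpace ℝ EG] [NormedAddCommGroup EP] [NormedSpace ℝ EP]
  [NormedAddCommGroup EM] [NormedSpace ℝ EM] [NormedAddCommGroup EH] [NormedSpace ℝ EH]
  [TopologicalSpace G] [ChartedSpace EG G] [Group G]
  [TopologicalSpace H] [ChartedSpace EH H] [Group H]
  [TopologicalSpace P] [ChartedSpace EP P] [TopologicalSpace M] [ChartedSpace EM M]
  [IsManifold 𝓘(ℝ, EP) ∞ P]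
  {B : PrincipalBundle EG EP EM G P M} {A : Connection B} {X : LieCrossedModule EG EH G H}

/-- By the Peiffer identity `α (τ k⁻¹)` is conjugation by `k⁻¹`, so `α b⁻¹` is that conjugation
followed by `α a⁻¹`. This is functoriality of the action on decorations. -/
theorem LieCrossedModule.α_inv_mul_mul (X : LieCrossedModule EG EH G H) {a b : G} {k : H}
    (hb : b = X.τ k * a) (l h h' : H) :
    X.α a⁻¹ ((l * k)⁻¹ * (h' * h)) = X.α b⁻¹ (l⁻¹ * h') * X.α a⁻¹ (k⁻¹ * h) := by
  rw [hb, mul_inv_rev (X.τ k), ← map_inv X.τ, map_mul X.α, MulAut.mul_apply, X.α_τ, ← map_mul]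
  congr 1
  group

/-- Equivariance of `τ` gives functoriality of the action on paths: it matches the two total
translations applied to the second path of a composite. -/
theorem LieCrossedModule.τ_mul_eq (X : LieCrossedModule EG EH G H) {a b : G} {k : H}
    (hb : b = X.τ k * a) (h : H) : X.τ h * a = b * X.τ (X.α a⁻¹ (k⁻¹ * h)) := by
  rw [X.τ_α, hb, map_mul, map_inv]
  group

/-- The decoration of a decorated path. -/
def DecCat.dec (F : Arrow (DecCat A X)) : H := DecHom.h F.hom

/-- The underlying path of a decorated path. -/
def DecCat.pathArrow (F : Arrow (DecCat A X)) : Arrow (PathCat EP P) :=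
  Arrow.mk (DecHom.path F.hom)

/-- A decorated path is determined by its decoration and its underlying path. -/
theorem DecCat.arrow_ext {F F' : Arrow (DecCat A X)} (h₁ : DecCat.dec F = DecCat.dec F')
    (h₂ : DecCat.pathArrow F = DecCat.pathArrow F') : F = F' := by
  obtain ⟨p, q, h, f, hf⟩ := F
  obtain ⟨p', q', h', f', hf'⟩ := F'
  obtain rfl : h = h' := h₁
  obtain rfl : p = p' := congrArg (fun F : Arrow (PathCat EP P) => F.left) h₂
  -- The path ends at `q τ(h)`, from which `q` is recovered because translation is injective.
  obtain rfl : q = q' := B.act_left_injective (X.τ h)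
    (congrArg (fun F : Arrow (PathCat EP P) => F.right) h₂)
  obtain rfl : f = f' := Arrow.mk_injective _ _ h₂
  rfl

theorem DecHom.ext_arrow {p q : DecCat A X} {f g : p ⟶ q} (h₁ : DecHom.h f = DecHom.h g)
    (h₂ : Arrow.mk (DecHom.path f) = Arrow.mk (DecHom.path g)) : f = g :=
  Arrow.mk_injective _ _ (DecCat.arrow_ext (F := Arrow.mk f) (F' := Arrow.mk g) h₁ h₂)

theorem DecHom.arrow_path_comp {p q r : DecCat A X} (f : p ⟶ q) (g : q ⟶ r) :
    Arrow.mk (DecHom.path (f ≫ g)) =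
      Arrow.mk (DecHom.path f ≫ (B.translate (X.τ (DecHom.h f))).map (DecHom.path g)) :=
  arrow_comp_congr rfl (arrow_comp_eqToHom _ _)

theorem DecHom.arrow_path_id (p : DecCat A X) :
    Arrow.mk (DecHom.path (𝟙 p)) = Arrow.mk (𝟙 p.toPath) := arrow_comp_eqToHom _ _

variable (A X)

theorem arrow_decProj_map {p q : DecCat A X} (f : p ⟶ q) :
    Arrow.mk ((decProj A X).map f) = Arrow.mk (B.projPath.map (DecHom.path f)) :=
  arrow_comp_eqToHom _ _

/-- The projection of the category of decorated paths to the category of paths on the base. -/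
def decProjFunctor : DecCat A X ⥤ PathCat EM M where
  obj := (decProj A X).obj
  map := (decProj A X).map
  map_id p := Arrow.mk_injective _ _ <| by
    rw [arrow_decProj_map, arrow_map_congr _ (DecHom.arrow_path_id p), B.projPath.map_id]
    rfl
  map_comp f g := Arrow.mk_injective _ _ <| by
    rw [arrow_decProj_map, arrow_map_congr _ (DecHom.arrow_path_comp f g), B.projPath.map_comp]
    exact arrow_comp_congr (arrow_decProj_map A X f).symm
      ((arrow_projPath_translate _ _).trans (arrow_decProj_map A X g).symm)

theorem decAct_map_h {x y : DecCat A X × X.Cat} (f : x ⟶ y) :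
    DecHom.h ((decAct A X).map f) = X.α x.2.toGroup⁻¹ (f.2.1⁻¹ * DecHom.h f.1) := rfl

theorem arrow_decAct_map_path {x y : DecCat A X × X.Cat} (f : x ⟶ y) :
    Arrow.mk (DecHom.path ((decAct A X).map f)) =
      Arrow.mk ((B.translate x.2.toGroup).map (DecHom.path f.1)) :=
  arrow_comp_eqToHom _ _

/-- The right action of the categorical group on the category of decorated paths. -/
def decActFunctor : DecCat A X × X.Cat ⥤ DecCat A X where
  obj := (decAct A X).obj
  map := (decAct A X).map
  map_id x := DecHom.ext_arrow
    (by
      rw [decAct_map_h]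
      change X.α x.2.toGroup⁻¹ (1⁻¹ * 1) = 1
      simp)
    (by
      rw [arrow_decAct_map_path]
      refine Eq.trans (arrow_map_congr _ (DecHom.arrow_path_id x.1)) ?_
      rw [CategoryTheory.Functor.map_id]
      exact (DecHom.arrow_path_id _).symm)
  map_comp {x y z} f g := by
    have hy : y.2.toGroup = X.τ f.2.1 * x.2.toGroup := f.2.2.symm
    refine DecHom.ext_arrow ?_ ?_
    · exact X.α_inv_mul_mul hy _ _ _
    · rw [DecHom.arrow_path_comp]
      refine (arrow_decAct_map_path A X _).trans ?_
      refine (arrow_map_congr _ (DecHom.arrow_path_comp f.1 g.1)).trans ?_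
      rw [Functor.map_comp]
      refine arrow_comp_congr (arrow_decAct_map_path A X f).symm ?_
      refine (arrow_translate_mul _ _ _).trans ?_
      refine Eq.trans ?_ (arrow_translate_congr (arrow_decAct_map_path A X g) rfl).symm
      refine Eq.trans ?_ (arrow_translate_mul _ _ _).symm
      refine arrow_translate_congr rfl ?_
      exact X.τ_mul_eq hy _

variable {A X}

theorem dec_actMor (F : Arrow (DecCat A X)) (φ : Arrow X.Cat) :
    DecCat.dec (actMor (decActFunctor A X) F φ) =
      X.α (φ.left.toGroup)⁻¹ (φ.hom.1⁻¹ * DecCat.dec F) := rfl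

theorem pathArrow_actMor (F : Arrow (DecCat A X)) (φ : Arrow X.Cat) :
    DecCat.pathArrow (actMor (decActFunctor A X) F φ) =
      (B.translate φ.left.toGroup).mapArrow.obj (DecCat.pathArrow F) :=
  arrow_decAct_map_path A X _

theorem mapArrow_decProjFunctor (F : Arrow (DecCat A X)) :
    (decProjFunctor A X).mapArrow.obj F = B.projPath.mapArrow.obj (DecCat.pathArrow F) :=
  arrow_decProj_map A X F.hom

variable (A X) in
theorem isRightAction_decActFunctor : IsRightAction (decActFunctor A X) where
  obj_one p := B.act_one p
  obj_mul p a b := B.act_mul p a.toGroup b.toGroup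
  mor_one F := DecCat.arrow_ext
    (by
      rw [dec_actMor]
      change X.α (1 : G)⁻¹ ((1 : H)⁻¹ * DecCat.dec F) = DecCat.dec F
      simp)
    ((pathArrow_actMor F 1).trans (arrow_translate_one _))
  mor_mul F φ ψ := DecCat.arrow_ext
    (by
      simp only [dec_actMor]
      change _ = X.α (φ.left.toGroup * ψ.left.toGroup)⁻¹
        ((φ.hom.1 * X.α φ.left.toGroup ψ.hom.1)⁻¹ * DecCat.dec F)
      simp [mul_assoc])
    (by
      rw [pathArrow_actMor, pathArrow_actMor, pathArrow_actMor]
      exact arrow_translate_mul _ _ _)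

variable [LieGroup 𝓘(ℝ, EG) ∞ G] [CompleteSpace EG]

/-- Each horizontal representative is a lift of its own projection, so uniqueness of lifts of
backtrack classes applies. -/
theorem Connection.IsHorizontal.arrow_eq {p q q' : PathCat EP P} {f : p ⟶ q} {f' : p ⟶ q'}
    (hf : A.IsHorizontal f) (hf' : A.IsHorizontal f')
    (h : Arrow.mk (B.projPath.map f) = Arrow.mk (B.projPath.map f')) :
    Arrow.mk f = Arrow.mk f' := by
  obtain ⟨γ, hγ, rfl⟩ := hf
  obtain ⟨γ', hγ', rfl⟩ := hf'
  have hB : ContMDiff 𝓘(ℝ, EP) 𝓘(ℝ, EM) 1 B.proj :=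
    B.contMDiff_proj.of_le (by exact_mod_cast le_top)
  exact (A.isPathLift_map hB hγ).arrow_eq (A.isPathLift_map hB hγ') h

variable (A X)

/-- A horizontal path decorated with `1`. -/
def DecHom.ofPath (p q : DecCat A X) (f : p.toPath ⟶ q.toPath) (hf : A.IsHorizontal f) :
    p ⟶ q where
  h := 1
  path := f ≫ eqToHom (by rw [map_one, translate_obj_one])
  horizontal := hf.eqToHom A _

theorem decProjFunctor_mapArrow_surjective :
    Function.Surjective (decProjFunctor A X).mapArrow.obj := by
  rintro ⟨x, y, f⟩
  induction f using Quotient.inductionOn with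
  | h c =>
    obtain ⟨p, hp⟩ := B.proj_surjective x
    obtain ⟨q, γ, hγ⟩ := A.exists_isPathLift c hp
    obtain rfl : B.proj p = x := hp
    obtain rfl : B.proj q = y := hγ.proj_target
    refine ⟨Arrow.mk (DecHom.ofPath A X p q (BtPath.mk γ) ⟨γ, hγ.isHorizontalPath, rfl⟩), ?_⟩
    rw [mapArrow_decProjFunctor]
    refine (congrArg B.projPath.mapArrow.obj (arrow_comp_eqToHom _ _)).trans ?_
    refine congrArg (BtPath.arrow (E := EM) (X := M)) (Quotient.sound (.rel _ _ (.of_isReparam ?_)))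
    -- The projected lift and `c` need agree only on the domain, so they are compared as
    -- reparametrizations and not as equal structures.
    refine PwPath.isReparam_of_eqOn hγ.len_eq fun t ht => hγ.isLift.proj_eq t ?_
    rw [← hγ.len_eq]
    exact ht

theorem decActFunctor_mor_transitive (F F' : Arrow (DecCat A X))
    (h : (decProjFunctor A X).mapArrow.obj F = (decProjFunctor A X).mapArrow.obj F') :
    ∃ φ : Arrow X.Cat, actMor (decActFunctor A X) F φ = F' := by
  rw [mapArrow_decProjFunctor, mapArrow_decProjFunctor] at h
  obtain ⟨p, q, k, f, hf⟩ := F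
  obtain ⟨p', q', k', f', hf'⟩ := F'
  change Arrow.mk (B.projPath.map f) = Arrow.mk (B.projPath.map f') at h
  obtain ⟨a, rfl⟩ := B.exists_act_eq
    (congrArg (fun F : Arrow (PathCat EM M) => F.left) h : B.proj p = B.proj p')
  -- The source condition gives `a`; the `H`-component solves `α(a⁻¹)(h₁⁻¹ k) = k'`.
  refine ⟨Arrow.mk (X := (a : X.Cat)) (Y := (X.τ (k * (X.α a k')⁻¹) * a : G))
    ⟨k * (X.α a k')⁻¹, rfl⟩, DecCat.arrow_ext ?_ ?_⟩
  · refine (dec_actMor _ _).trans ?_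
    change X.α a⁻¹ ((k * (X.α a k')⁻¹)⁻¹ * k) = k'
    simp
  · refine (pathArrow_actMor _ _).trans ?_
    exact (hf.translate A a).arrow_eq hf' ((arrow_projPath_translate f a).trans h)

theorem isPrincipalCategoricalBundle_decActFunctor :
    IsPrincipalCategoricalBundle (decProjFunctor A X) (decActFunctor A X) where
  rightAction := isRightAction_decActFunctor A X
  obj_surjective := B.proj_surjective
  mor_surjective := decProjFunctor_mapArrow_surjective A X
  obj_free p a h := B.act_free p a h
  mor_free F φ h := by
    have h1 := congrArg DecCat.dec h
    rw [dec_actMor] at h1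
    obtain ⟨a, b, k, hk⟩ := φ
    -- Freeness on the source gives `a = 1`, after which equality of decorations reads `k⁻¹ h = h`.
    obtain rfl : a = 1 := B.act_free F.left a (congrArg (fun F : Arrow (DecCat A X) => F.left) h)
    refine X.arrow_ext rfl ?_
    change X.α (1 : G)⁻¹ (k⁻¹ * DecCat.dec F) = DecCat.dec F at h1
    change k = 1
    simpa using h1
  obj_fiber p a := B.proj_act p a
  mor_fiber F φ := by
    rw [mapArrow_decProjFunctor, mapArrow_decProjFunctor, pathArrow_actMor]
    exact arrow_projPath_translate _ _
  obj_transitive p q h := B.exists_act_eq h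
  mor_transitive := decActFunctor_mor_transitive A X

end Decorated

end CatBundle

end

theorem theoremT {EG EH EP EM G H P M : Type*}
    [NormedAddCommGroup EG] [NormedSpace ℝ EG] [FiniteDimensional ℝ EG]
    [NormedAddCommGroup EH] [NormedSpace ℝ EH] [FiniteDimensional ℝ EH]
    [NormedAddCommGroup EP] [NormedSpace ℝ EP] [FiniteDimensional ℝ EP]
    [NormedAddCommGroup EM] [NormedSpace ℝ EM] [FiniteDimensional ℝ EM]
    [TopologicalSpace G] [ChartedSpace EG G] [Group G] [LieGroup 𝓘(ℝ, EG) ∞ G] [T2Space G]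
    [TopologicalSpace H] [ChartedSpace EH H] [Group H] [LieGroup 𝓘(ℝ, EH) ∞ H] [T2Space H]
    [TopologicalSpace P] [ChartedSpace EP P] [IsManifold 𝓘(ℝ, EP) ∞ P] [T2Space P]
    [TopologicalSpace M] [ChartedSpace EM M] [IsManifold 𝓘(ℝ, EM) ∞ M] [T2Space M]
    (X : CatBundle.LieCrossedModule EG EH G H)
    (B : CatBundle.PrincipalBundle EG EP EM G P M)
    (A : CatBundle.Connection B) :
    ∃ (π : CatBundle.DecCat A X ⥤ CatBundle.PathCat EM M)
      (ρ : CatBundle.DecCat A X × X.Cat ⥤ CatBundle.DecCat A X),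
      π.toPrefunctor = CatBundle.decProj A X ∧
      ρ.toPrefunctor = CatBundle.decAct A X ∧
      CatBundle.IsPrincipalCategoricalBundle π ρ := by
  -- Completeness enters through Picard-Lindelöf and the integral in `eq_of_velocity_eq_zero`.
  have hEG : CompleteSpace EG := FiniteDimensional.complete ℝ EG
  exact ⟨CatBundle.decProjFunctor A X, CatBundle.decActFunctor A X, rfl, rfl,
    CatBundle.isPrincipalCategoricalBundle_decActFunctor A X⟩
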